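/- Let $n\ge 0$ and let $q_0,\dots,q_n\in\mathbb R^n$ be the vertices of an $n$-simplex with sides of unit length. Put $F_i(x)=\tfrac12(x+q_i)$, and let $S_n\subset\mathbb R^n$ be the Sierpinski $n$-gasket, i.e. the unique nonempty compact set with $S_n=\bigcup_{i=0}^n F_i(S_n)$. Let $V_n^0=\{q_0,\dots,q_n\}$, $V_n^{m+1}=\bigcup_i F_i(V_n^m)$, and let $V_n^*=\bigcup_m V_n^m$ be the set of vertices. Let $d(x,y)$, for $x,y\in S_n$, be the infimum of $\mathcal H^1(\gamma([0,1]))$ over all continuous $\gamma:[0,1]\to S_n$ with $\gamma(0)=x$, $\gamma(1)=y$. For $t\in(0,1)$, $a,b\in S_n$ and $A,B\subseteq S_n$ set $$\tilde Z_t(a,b)=\{x\in S_n: d(a,x)=t\,d(a,b),\ d(x,b)=(1-t)\,d(a,b)\},\qquad \tilde Z_t(A,B)=\bigcup_{a\in A,\,b\in B}\tilde Z_t(a,b),$$ and let $\tilde Z_t^{\ne}(A,B)$ be the union of $\tilde Z_t(a,b)$ over all $a\in A$, $b\in B$ with $a\neq b$ (so $\tilde Z_t^{\neq}(A,B)=\tilde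 Z_t(A,B)$ if $A\cap B=\emptyset$). 1. There is a countable collection $\mathcal L$ of Euclidean line segments contained in $S_n$, each joining two points of $V_n^*$, such that $\bigcup_{t\in(0,1)}\tilde Z_t^{\neq}(A,B)\subseteq\bigcup_{L\in\mathcal L}L$ for all $A,B\subseteq S_n$. 2. For all $A,B\subseteq S_n$, the set $\bigcup_{t\in(0,1)}\tilde Z_t^{\neq}(A,B)$ has Hausdorff dimension at most $1$, and $\dim_H\bigcup_{t\in(0,1)}\tilde Z_t(A,B)\le\max\{1,\dim_H(A\cap B)\}$. 3. Let $n\ge2$ and let $\mu_n$ be a self-similar probability measure on $S_n$ with weights $\mu_n^i>0$, $\sum_i\mu_n^i=1$, that is, $\mu_n(X)=\sum_i\mu_n^i\,\mu_n(F_i^{-1}(X))$ for all measurable $X\subseteq S_n$. Then, for all $A,B\subseteq S_n$, $\mu_n\bigl(\bigcup_{t\in(0,1)}\tilde Z_t^{\neq}(A,B)\bigr)=0$ and $\mu_n\bigl(\bigcup_{t\in(0,1)}\tilde Z_t(A,B)\bigr)=\mu_n(A\cap B)$ (outer measure for non-measurable sets). In particular, if $A\cap B=\emptyset$, then $\bigcup_{t\in(0,1)}\tilde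 Z_t(A,B)$ has Hausdorff dimension at most $1$ and, for $n\ge2$, $\mu_n$-measure zero. 4. Consequently no direct Brunn–Minkowski inequality holds for $\mu_n$: for $n\ge2$ and each $\mu_n$ as in 3, there are disjoint compact sets $A,B\subseteq S_n$ of positive $\mu_n$-measure such that for all $t\in(0,1)$ and all $r>0$ $$\mu_n(\tilde Z_t(A,B))^{r}<(1-t)\,\mu_n(A)^{r}+t\,\mu_n(B)^{r}.$$ -/

import Mathlib

open Set MeasureTheory
open scoped ENNReal NNReal

namespace SierpinskiGasket

/-- The ambient Euclidean space `ℝⁿ`. -/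
abbrev Pt (n : ℕ) : Type := EuclideanSpace ℝ (Fin n)

/-- `q` lists the `n + 1` vertices of an `n`-simplex with sides of unit length. -/
def IsUnitSimplex {n : ℕ} (q : Fin (n + 1) → Pt n) : Prop :=
  ∀ i j, i ≠ j → dist (q i) (q j) = 1

/-- The contraction `F_i(x) = (x + q_i) / 2`. -/
noncomputable def ifsMap {n : ℕ} (q : Fin (n + 1) → Pt n) (i : Fin (n + 1)) (x : Pt n) : Pt n :=
  (1 / 2 : ℝ) • (x + q i)

/-- The point with infinite address `w`, that is, `lim F_{w 0} ∘ ⋯ ∘ F_{w (m-1)} (x)`. -/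
noncomputable def addressPt {n : ℕ} (q : Fin (n + 1) → Pt n) (w : ℕ → Fin (n + 1)) : Pt n :=
  ∑' k : ℕ, (1 / 2 : ℝ) ^ (k + 1) • q (w k)

/-- The Sierpinski `n`-gasket with vertices `q`: the set of all points with an infinite address.
By `gasket_nonempty`, `isCompact_gasket`, `gasket_eq_iUnion` and `eq_gasket` below, it is the
unique nonempty compact set `K` with `K = ⋃ i, F_i '' K`. -/
noncomputable def gasket {n : ℕ} (q : Fin (n + 1) → Pt n) : Set (Pt n) :=
  range (addressPt q)

/-- The vertices of level `m`: `V⁰ = {q_0, …, q_n}` and `V^{m+1} = ⋃ i, F_i '' V^m`. -/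
noncomputable def vertexLevel {n : ℕ} (q : Fin (n + 1) → Pt n) : ℕ → Set (Pt n)
  | 0 => range q
  | m + 1 => ⋃ i, ifsMap q i '' vertexLevel q m

/-- The set `V*` of all vertices of the gasket. -/
noncomputable def vertices {n : ℕ} (q : Fin (n + 1) → Pt n) : Set (Pt n) :=
  ⋃ m, vertexLevel q m

/-- The intrinsic metric of the gasket: the infimum of `ℋ¹(γ([0,1]))` over the continuous
`γ : [0,1] → S_n` from `x` to `y`. -/
noncomputable def intrinsicDist {n : ℕ} (q : Fin (n + 1) → Pt n) (x y : Pt n) : ℝ :=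
  (⨅ (γ : Path x y) (_ : ∀ s, γ s ∈ gasket q), μH[1] (range γ)).toReal

/-- `Z̃_t(a, b)`, the set of the `x ∈ S_n` with `d(a,x) = t d(a,b)` and `d(x,b) = (1-t) d(a,b)`. -/
def interpPt {n : ℕ} (q : Fin (n + 1) → Pt n) (t : ℝ) (a b : Pt n) : Set (Pt n) :=
  {x | x ∈ gasket q ∧ intrinsicDist q a x = t * intrinsicDist q a b ∧
    intrinsicDist q x b = (1 - t) * intrinsicDist q a b}

/-- `Z̃_t(A, B)`, the union of `Z̃_t(a, b)` over all `a ∈ A`, `b ∈ B`. -/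
def interp {n : ℕ} (q : Fin (n + 1) → Pt n) (t : ℝ) (A B : Set (Pt n)) : Set (Pt n) :=
  ⋃ a ∈ A, ⋃ b ∈ B, interpPt q t a b

/-- The union of `Z̃_t(a, b)` over all `a ∈ A`, `b ∈ B` with `a ≠ b`. -/
def interpDistinct {n : ℕ} (q : Fin (n + 1) → Pt n) (t : ℝ) (A B : Set (Pt n)) : Set (Pt n) :=
  ⋃ a ∈ A, ⋃ b ∈ B, ⋃ (_ : a ≠ b), interpPt q t a b

/-- `μ` is the self-similar probability measure on the gasket with the positive weights `p`.
It is regarded as a Borel measure on `ℝⁿ` that gives no mass to the complement of `S_n`. -/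
structure IsSelfSimilarMeasure {n : ℕ} (q : Fin (n + 1) → Pt n) (p : Fin (n + 1) → ℝ≥0)
    (μ : Measure (Pt n)) : Prop where
  weight_pos : ∀ i, 0 < p i
  weight_sum : ∑ i, p i = 1
  prob : IsProbabilityMeasure μ
  supported : μ (gasket q)ᶜ = 0
  selfSimilar : ∀ X : Set (Pt n), MeasurableSet X → X ⊆ gasket q →
    μ X = ∑ i, (p i : ℝ≥0∞) * μ (ifsMap q i ⁻¹' X)

section Basic

variable {n : ℕ} (q : Fin (n + 1) → Pt n)

lemma norm_term_le (w : ℕ → Fin (n + 1)) (k : ℕ) :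
    ‖(1 / 2 : ℝ) ^ (k + 1) • q (w k)‖ ≤ (1 / 2 : ℝ) ^ (k + 1) * ∑ i, ‖q i‖ := by
  rw [norm_smul, Real.norm_of_nonneg (by positivity)]
  gcongr
  exact Finset.single_le_sum (f := fun i => ‖q i‖) (fun i _ => norm_nonneg _) (Finset.mem_univ _)

lemma summable_bound : Summable fun k : ℕ => (1 / 2 : ℝ) ^ (k + 1) * ∑ i, ‖q i‖ :=
  ((summable_nat_add_iff 1).2 summable_geometric_two).mul_right _

lemma summable_term (w : ℕ → Fin (n + 1)) :
    Summable fun k : ℕ => (1 / 2 : ℝ) ^ (k + 1) • q (w k) :=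
  Summable.of_norm_bounded (summable_bound q) (norm_term_le q w)

lemma addressPt_eq (w : ℕ → Fin (n + 1)) :
    addressPt q w = ifsMap q (w 0) (addressPt q fun k => w (k + 1)) := by
  unfold addressPt ifsMap
  rw [(summable_term q w).tsum_eq_zero_add, smul_add, ← tsum_const_smul'', add_comm]
  congr 1
  · refine tsum_congr fun k => ?_
    rw [smul_smul]; congr 1; ring
  · simp

lemma continuous_addressPt : Continuous (addressPt q) := by
  unfold addressPt
  refine continuous_tsum (fun k => ?_) (summable_bound q) fun k w => norm_term_le q w k
  have : Continuous q := continuous_of_discreteTopology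
  fun_prop

theorem gasket_nonempty : (gasket q).Nonempty := range_nonempty _

theorem isCompact_gasket : IsCompact (gasket q) := isCompact_range (continuous_addressPt q)

/-- Prepending a letter to an infinite address. -/
def consWord (i : Fin (n + 1)) (w : ℕ → Fin (n + 1)) : ℕ → Fin (n + 1)
  | 0 => i
  | k + 1 => w k

lemma addressPt_consWord (i : Fin (n + 1)) (w : ℕ → Fin (n + 1)) :
    addressPt q (consWord i w) = ifsMap q i (addressPt q w) :=
  addressPt_eq q _

theorem gasket_eq_iUnion : gasket q = ⋃ i, ifsMap q i '' gasket q := by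
  ext x
  simp only [gasket, mem_iUnion, mem_image, mem_range, exists_exists_eq_and]
  constructor
  · rintro ⟨w, rfl⟩
    exact ⟨w 0, _, (addressPt_eq q w).symm⟩
  · rintro ⟨i, w, rfl⟩
    exact ⟨_, addressPt_consWord q i w⟩

lemma dist_ifsMap (i : Fin (n + 1)) (x y : Pt n) :
    dist (ifsMap q i x) (ifsMap q i y) = (1 / 2 : ℝ) * dist x y := by
  simp [ifsMap, dist_eq_norm, ← smul_sub, norm_smul]

/-- If `K` and `L` are nonempty compact sets with `K ⊆ ⋃ i, F_i '' K` and
`⋃ i, F_i '' L ⊆ L`, then `K ⊆ L`. -/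
lemma subset_of_invariant {K L : Set (Pt n)} (hK : IsCompact K) (hL : IsCompact L)
    (hL0 : L.Nonempty) (hKi : K ⊆ ⋃ i, ifsMap q i '' K) (hLi : ⋃ i, ifsMap q i '' L ⊆ L) :
    K ⊆ L := by
  intro x hx
  obtain ⟨y, hy, hmax⟩ := hK.exists_isMaxOn ⟨x, hx⟩ (Metric.continuous_infDist_pt L).continuousOn
  obtain ⟨i, z, hz, hzy⟩ := mem_iUnion.1 (hKi hy)
  obtain ⟨v, hv, hzv⟩ := hL.exists_infDist_eq_dist hL0 z
  have h1 : Metric.infDist y L ≤ (1 / 2 : ℝ) * Metric.infDist z L := by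
    rw [hzv, ← dist_ifsMap q i, hzy]
    exact Metric.infDist_le_dist_of_mem (hLi (mem_iUnion.2 ⟨i, v, hv, rfl⟩))
  have h2 : Metric.infDist z L ≤ Metric.infDist y L := hmax hz
  have h3 : Metric.infDist x L ≤ Metric.infDist y L := hmax hx
  have h4 : 0 ≤ Metric.infDist x L := Metric.infDist_nonneg
  exact (hL.isClosed.mem_iff_infDist_zero hL0).2 (by linarith)

theorem eq_gasket {K : Set (Pt n)} (h0 : K.Nonempty) (hK : IsCompact K)
    (h : K = ⋃ i, ifsMap q i '' K) : K = gasket q :=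
  (subset_of_invariant q hK (isCompact_gasket q) (gasket_nonempty q) h.le
    (gasket_eq_iUnion q).ge).antisymm
  (subset_of_invariant q (isCompact_gasket q) hK h0 (gasket_eq_iUnion q).le h.ge)

lemma measurable_ifsMap (i : Fin (n + 1)) : Measurable (ifsMap q i) := by
  unfold ifsMap; fun_prop

lemma measurable_consWord (i : Fin (n + 1)) : Measurable (consWord (n := n) i) := by
  refine measurable_pi_iff.2 fun k => ?_
  cases k with
  | zero => exact measurable_const
  | succ k => exact measurable_pi_apply k

end Basic

/-- Self-similar measures exist for all choices of positive weights with sum one. -/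
theorem exists_isSelfSimilarMeasure {n : ℕ} (q : Fin (n + 1) → Pt n) (p : Fin (n + 1) → ℝ≥0)
    (hp : ∀ i, 0 < p i) (hsum : ∑ i, p i = 1) : ∃ μ, IsSelfSimilarMeasure q p μ := by
  set P : Measure (Fin (n + 1)) := ∑ i, p i • Measure.dirac i with hP
  have hsum' : ∑ i, (p i : ℝ≥0∞) = 1 := by exact_mod_cast hsum
  have hPap : ∀ s, P s = ∑ i, (p i : ℝ≥0∞) * s.indicator 1 i := by
    intro s
    rw [hP, Measure.finsetSum_apply]
    refine Finset.sum_congr rfl fun i _ => ?_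
    rw [Measure.smul_apply, Measure.dirac_apply' i (Set.toFinite s).measurableSet]
    rfl
  have : IsProbabilityMeasure P := ⟨by simp [hPap, hsum']⟩
  set ν : Measure (ℕ → Fin (n + 1)) := Measure.infinitePi fun _ => P with hν
  have key : ∑ i, p i • ν.map (consWord i) = ν := by
    refine Measure.eq_infinitePi _ fun s t ht => ?_
    classical
    obtain ⟨N, hN⟩ := s.exists_nat_subset_range
    set t' : ℕ → Set (Fin (n + 1)) := fun k => if k ∈ s then t k else univ with ht'
    have hpi : Set.pi s t = Set.pi (Finset.range (N + 1)) t' := by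
      ext w
      simp only [Set.mem_pi, Finset.mem_coe, ht']
      constructor
      · intro h k _
        by_cases hk : k ∈ s
        · rw [if_pos hk]
          exact h k hk
        · rw [if_neg hk]
          exact mem_univ _
      · intro h k hk
        have := h k (Finset.range_mono (Nat.le_succ N) (hN hk))
        simpa [hk] using this
    have hprod : ∏ k ∈ s, P (t k) = ∏ k ∈ Finset.range (N + 1), P (t' k) := by
      rw [← Finset.prod_subset (hN.trans (Finset.range_mono (Nat.le_succ N)))]
      · exact Finset.prod_congr rfl fun k hk => by simp [ht', hk]
      · intro k _ hk
        simp [ht', hk]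
    rw [hpi, hprod, Finset.prod_range_succ', Measure.finsetSum_apply]
    have hpre : ∀ i, consWord i ⁻¹' (Set.pi (Finset.range (N + 1)) t') =
        if i ∈ t' 0 then Set.pi (Finset.range N) (fun k => t' (k + 1)) else ∅ := by
      intro i
      ext w
      have : w ∈ consWord i ⁻¹' (Set.pi (Finset.range (N + 1)) t') ↔
          i ∈ t' 0 ∧ w ∈ Set.pi (Finset.range N) (fun k => t' (k + 1)) := by
        simp only [mem_preimage, Set.mem_pi, Finset.mem_coe, Finset.mem_range]
        constructor
        · intro h
          exact ⟨h 0 (Nat.succ_pos N), fun k hk => h (k + 1) (Nat.succ_lt_succ hk)⟩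
        · rintro ⟨h0, h⟩ k hk
          cases k with
          | zero => exact h0
          | succ k => exact h k (Nat.lt_of_succ_lt_succ hk)
      rw [this]
      split_ifs with h <;> simp [h]
    have hmeas : MeasurableSet (Set.pi (Finset.range (N + 1) : Set ℕ) t') :=
      MeasurableSet.pi (Finset.countable_toSet _) fun k _ => (Set.toFinite (t' k)).measurableSet
    rw [hPap, Finset.mul_sum]
    refine Finset.sum_congr rfl fun i _ => ?_
    rw [Measure.smul_apply, Measure.map_apply (measurable_consWord i) hmeas, hpre]
    by_cases h : i ∈ t' 0
    · rw [if_pos h, hν, Measure.infinitePi_pi _ fun k _ => (Set.toFinite _).measurableSet]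
      simp [h, ENNReal.smul_def, mul_comm]
    · simp [h]
  have hc : Measurable (addressPt q) := (continuous_addressPt q).measurable
  refine ⟨ν.map (addressPt q), hp, hsum, Measure.isProbabilityMeasure_map hc.aemeasurable, ?_, ?_⟩
  · rw [Measure.map_apply hc (isCompact_gasket q).measurableSet.compl]
    have : addressPt q ⁻¹' (gasket q)ᶜ = ∅ := by
      ext w; simp [gasket]
    simp [this]
  · intro X hX _
    rw [Measure.map_apply hc hX]
    conv_lhs => rw [← key]
    rw [Measure.finsetSum_apply]
    refine Finset.sum_congr rfl fun i _ => ?_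
    rw [Measure.smul_apply, Measure.map_apply (measurable_consWord i) (hc hX),
      Measure.map_apply hc (measurable_ifsMap q i hX), ENNReal.smul_def, smul_eq_mul]
    congr 2
    ext w
    simp [addressPt_consWord]

end SierpinskiGasket

/-! The key is that every interior point of a geodesic lies on an edge of some cell. The edges of
cells form a countable family `cellEdges` that does not depend on `A` and `B`, and the dimension and
measure statements follow from this.

Let `x` satisfy `d(a,x) + d(x,b) = d(a,b)` with `x ≠ a, b`. Choose a cell `F_w(S)` of level `m` that
contains `x = F_w(y)` and is so small that it contains neither `a` nor `b`. A cell is attached to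
the rest of the gasket only at its corners, so paths from `a` and from `b` to `x` enter it through
corners `u = F_w(q_i)` and `v = F_w(q_j)`. Inside the cell, a path from the corner `F_w(q_i)` to `x`
has length at least `2⁻ᵐ(1 - y_i)`, where `y_i` is the barycentric coordinate
(`ofReal_one_sub_coord_le`, used in `exists_corner_add_le`). On the other hand, the route from `a`
by `u` and `v` to `b` gives `d(a,b) ≤ d(a,u) + 2⁻ᵐ|q_i - q_j| + d(v,b)`. Hence `(1 - y_i) + (1 -
y_j) ≤ |q_i - q_j|`. If `i ≠ j`, then `y_i + y_j ≥ 1` and `y` lies on the edge from `q_i` to `q_j`;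
if `i = j`, then `y = q_i`. This is `mem_sUnion_cellEdges`.

For `n ≥ 2` a self-similar measure vanishes on edges: only the maps `F_i` and `F_j` contribute to
the edge from `q_i` to `q_j`, and their weights sum to less than one (`measure_edge`). The pairs
with `a = b` add exactly `A ∩ B` (`iUnion_interp_eq`). Two disjoint cells then violate every
Brunn–Minkowski inequality. -/

namespace SierpinskiGasket

/-! ### Splitting paths at a finite interface. -/

section Topology

variable {X : Type*} [TopologicalSpace X]

lemma exists_continuous_of_joinedIn {R : Set X} {a b : X} (h : JoinedIn R a b) :
    ∃ γ : ℝ → X, Continuous γ ∧ γ 0 = a ∧ γ 1 = b ∧ ∀ s, γ s ∈ R := by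
  obtain ⟨γ, hγ⟩ := h
  exact ⟨γ.extend, γ.continuous_extend, γ.extend_zero, γ.extend_one, fun s => hγ _⟩

lemma exists_isPathConnected_of_joinedIn {R : Set X} {a b : X} (h : JoinedIn R a b) :
    ∃ K ⊆ R, IsPathConnected K ∧ a ∈ K ∧ b ∈ K := by
  obtain ⟨γ, hγ, h0, h1, hR⟩ := exists_continuous_of_joinedIn h
  exact ⟨range γ, range_subset_iff.2 hR, isPathConnected_range hγ, ⟨0, h0⟩, ⟨1, h1⟩⟩

lemma joinedIn_image_Icc {γ : ℝ → X} (hγ : Continuous γ) {s t : ℝ} (hst : s ≤ t) :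
    JoinedIn (γ '' Icc s t) (γ s) (γ t) :=
  (((convex_Icc s t).isPathConnected (nonempty_Icc.2 hst)).image hγ).joinedIn _
    (mem_image_of_mem _ (left_mem_Icc.2 hst)) _ (mem_image_of_mem _ (right_mem_Icc.2 hst))

/-- A curve in `C ∪ D` that starts in `D` and ends in `C` has a last point in `D`, and this
point belongs to `C ∩ D`. -/
lemma exists_last_mem {γ : ℝ → X} (hγ : Continuous γ) {C D : Set X} (hC : IsClosed C)
    (hD : IsClosed D) (hCD : ∀ s, γ s ∈ C ∪ D) {t : ℝ} (ht : 0 ≤ t) (h0 : γ 0 ∈ D)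
    (h1 : γ t ∈ C) :
    ∃ s, 0 ≤ s ∧ s ≤ t ∧ γ s ∈ C ∩ D ∧ γ '' Icc s t ⊆ C := by
  have hcomp : IsCompact (Icc 0 t ∩ γ ⁻¹' D) := isCompact_Icc.inter_right (hD.preimage hγ)
  obtain ⟨s, ⟨⟨hs0, hst⟩, hsD⟩, hmax⟩ := hcomp.exists_isGreatest ⟨0, left_mem_Icc.2 ht, h0⟩
  have hafter : ∀ r ∈ Ioc s t, γ r ∈ C := fun r hr =>
    (hCD r).resolve_right fun h => (hmax ⟨⟨hs0.trans hr.1.le, hr.2⟩, h⟩).not_gt hr.1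
  have hsC : γ s ∈ C := by
    rcases hst.eq_or_lt with rfl | hlt
    · exact h1
    · have : s ∈ closure (Ioc s t) := by
        rw [closure_Ioc hlt.ne]; exact left_mem_Icc.2 hst
      exact closure_minimal (s := Ioc s t) (t := γ ⁻¹' C) hafter (hC.preimage hγ) this
  refine ⟨s, hs0, hst, ⟨hsC, hsD⟩, ?_⟩
  rintro _ ⟨r, hr, rfl⟩
  rcases hr.1.eq_or_lt with rfl | hlt
  · exact hsC
  · exact hafter r ⟨hlt, hr.2⟩

/-- A path from `D` to `C` through a finite interface `C ∩ D` contains a path to a point `u` of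
the interface and a path from `u` inside `C` that meet only in `u`. -/
lemma exists_split_of_joinedIn [T1Space X] {R C D : Set X} {a x : X} (h : JoinedIn R a x)
    (hC : IsClosed C) (hD : IsClosed D) (hR : R ⊆ C ∪ D) (hfin : (C ∩ D).Finite)
    (ha : a ∈ D) (hx : x ∈ C) :
    ∃ u ∈ C ∩ D, ∃ R₁ ⊆ R, ∃ R₂ ⊆ R ∩ C, IsCompact R₁ ∧ JoinedIn R₁ a u ∧ JoinedIn R₂ u x ∧
      R₂ ∩ R₁ ⊆ {u} := by
  obtain ⟨γ, hγ, rfl, rfl, hγR⟩ := exists_continuous_of_joinedIn h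
  have hCD : ∀ s, γ s ∈ C ∪ D := fun s => hR (hγR s)
  -- `Q` consists of the interface points from which the end point can be reached inside `R ∩ C`.
  -- Stopping `γ` at its first visit to `Q` keeps the two pieces apart without passing to an
  -- injective arc.
  set Q : Set X := {u | u ∈ C ∩ D ∧ JoinedIn (R ∩ C) u (γ 1)} with hQ
  have hQfin : Q.Finite := hfin.subset fun u hu => hu.1
  have hlast : ∀ t, 0 ≤ t → JoinedIn (R ∩ C) (γ t) (γ 1) →
      ∃ s, 0 ≤ s ∧ s ≤ t ∧ γ s ∈ Q := by
    intro t ht hj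
    obtain ⟨s, hs0, hst, hsCD, hsub⟩ := exists_last_mem hγ hC hD hCD ht ha hj.source_mem.2
    refine ⟨s, hs0, hst, hsCD, JoinedIn.trans ((joinedIn_image_Icc hγ hst).mono ?_) hj⟩
    exact subset_inter (by rintro _ ⟨r, -, rfl⟩; exact hγR r) hsub
  have hcomp : IsCompact (Icc 0 1 ∩ γ ⁻¹' Q) :=
    isCompact_Icc.inter_right (hQfin.isClosed.preimage hγ)
  obtain ⟨s₀, hs0, hs1, hsQ⟩ := hlast 1 zero_le_one (.refl ⟨hγR 1, hx⟩)
  obtain ⟨τ, ⟨⟨hτ0, hτ1⟩, hτQ⟩, hmin⟩ := hcomp.exists_isLeast ⟨s₀, ⟨hs0, hs1⟩, hsQ⟩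
  obtain ⟨hτCD, hτj⟩ := hτQ
  obtain ⟨K, hKsub, hK, hK0, hK1⟩ := exists_isPathConnected_of_joinedIn hτj
  refine ⟨γ τ, hτCD, γ '' Icc 0 τ, ?_, K, hKsub, isCompact_Icc.image hγ,
    joinedIn_image_Icc hγ hτ0, hK.joinedIn _ hK0 _ hK1, ?_⟩
  · rintro _ ⟨r, -, rfl⟩; exact hγR r
  · rintro _ ⟨hy, s, hs, rfl⟩
    -- A common point `γ s` is joined to the end point inside `R ∩ C`, so `γ` visits `Q` no later
    -- than at time `s`; minimality of `τ` forces `s = τ`.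
    have hj : JoinedIn (R ∩ C) (γ s) (γ 1) := (hK.joinedIn _ hy _ hK1).mono hKsub
    obtain ⟨σ, hσ0, hσs, hσQ⟩ := hlast s hs.1 hj
    have := hmin ⟨⟨hσ0, hσs.trans (hs.2.trans hτ1)⟩, hσQ⟩
    have : s = τ := le_antisymm hs.2 (this.trans hσs)
    rw [this]; rfl

end Topology

/-! ### Lower bounds and additivity for one-dimensional Hausdorff measure. -/

section Hausdorff

variable {X : Type*} [MetricSpace X] [MeasurableSpace X] [BorelSpace X]

/-- The length of a connected set is at least the distance between any two of its points. -/
lemma ofReal_dist_le_hausdorffMeasure {K : Set X} (hK : IsPreconnected K) {a b : X} (ha : a ∈ K)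
    (hb : b ∈ K) : ENNReal.ofReal (dist a b) ≤ μH[1] K := by
  have hlip : LipschitzWith 1 (fun x => dist a x) := LipschitzWith.dist_right a
  have hsub : Icc 0 (dist a b) ⊆ (fun x => dist a x) '' K := by
    have := (hK.image _ hlip.continuous.continuousOn).Icc_subset (mem_image_of_mem _ ha)
      (mem_image_of_mem _ hb)
    simpa using this
  calc ENNReal.ofReal (dist a b) = μH[1] (Icc 0 (dist a b)) := by
        rw [hausdorffMeasure_real, Real.volume_Icc, sub_zero]
    _ ≤ μH[1] ((fun x => dist a x) '' K) := measure_mono hsub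
    _ ≤ μH[1] K := by
        simpa using hlip.lipschitzOnWith (s := K) |>.hausdorffMeasure_image_le zero_le_one

lemma ofReal_dist_le_of_joinedIn {R : Set X} {a b : X} (h : JoinedIn R a b) :
    ENNReal.ofReal (dist a b) ≤ μH[1] R := by
  obtain ⟨K, hKR, hK, ha, hb⟩ := exists_isPathConnected_of_joinedIn h
  exact (ofReal_dist_le_hausdorffMeasure hK.isConnected.isPreconnected ha hb).trans (measure_mono hKR)

/-- Single points are null for `μH[1]`, so the two pieces supplied by `exists_split_of_joinedIn` are
disjoint almost everywhere. Only `R₁` has to be measurable, which compactness provides. -/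
lemma hausdorffMeasure_add_le {R R₁ R₂ : Set X} (h₁ : R₁ ⊆ R) (h₂ : R₂ ⊆ R)
    (hc : IsCompact R₁) {u : X} (hu : R₂ ∩ R₁ ⊆ {u}) : μH[1] R₁ + μH[1] R₂ ≤ μH[1] R := by
  have := Measure.nullSingletonClass_hausdorff X (d := 1) one_pos
  have hd : AEDisjoint μH[1] R₂ R₁ := measure_mono_null hu (measure_singleton u)
  rw [add_comm, ← measure_union₀ hc.measurableSet.nullMeasurableSet hd]
  exact measure_mono (union_subset h₂ h₁)

end Hausdorff

/-! ### Barycentric coordinates on the gasket. -/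

section Coordinates

variable {n : ℕ} (q : Fin (n + 1) → Pt n)

lemma ifsMap_injective (i : Fin (n + 1)) : Function.Injective (ifsMap q i) := by
  intro x y h
  have := dist_ifsMap q i x y
  rw [h, dist_self] at this
  exact dist_eq_zero.1 (by linarith)

lemma continuous_ifsMap (i : Fin (n + 1)) : Continuous (ifsMap q i) := by
  unfold ifsMap; fun_prop

lemma ifsMap_vertex (i : Fin (n + 1)) : ifsMap q i (q i) = q i := by
  rw [ifsMap, ← two_smul ℝ, smul_smul]; norm_num

lemma ifsMap_mem_gasket (i : Fin (n + 1)) {x : Pt n} (hx : x ∈ gasket q) :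
    ifsMap q i x ∈ gasket q := by
  rw [gasket_eq_iUnion]
  exact mem_iUnion.2 ⟨i, mem_image_of_mem _ hx⟩

/-- An induction principle: the points of the gasket with a closed property that the `F_i` preserve
form a compact set mapped into itself, so they exhaust the gasket as soon as there is one. -/
lemma gasket_subset_of_forall_ifsMap {P : Set (Pt n)} (hP : IsClosed P)
    (h0 : (gasket q ∩ P).Nonempty) (h : ∀ i, ∀ x ∈ gasket q, x ∈ P → ifsMap q i x ∈ P) :
    gasket q ⊆ P := by
  refine (subset_of_invariant q (isCompact_gasket q) ((isCompact_gasket q).inter_right hP) h0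
    (gasket_eq_iUnion q).le ?_).trans inter_subset_right
  refine iUnion_subset fun i => ?_
  rintro _ ⟨x, ⟨hx, hxP⟩, rfl⟩
  exact ⟨ifsMap_mem_gasket q i hx, h i x hx hxP⟩

lemma isCompact_segment (x y : Pt n) : IsCompact (segment ℝ x y) := by
  rw [segment_eq_image_lineMap]
  exact isCompact_Icc.image AffineMap.lineMap_continuous

/-- The gasket contains its edges. -/
lemma segment_subset_gasket (i j : Fin (n + 1)) : segment ℝ (q i) (q j) ⊆ gasket q := by
  refine subset_of_invariant q (isCompact_segment _ _) (isCompact_gasket q) (gasket_nonempty q) ?_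
    (gasket_eq_iUnion q).ge
  rintro _ ⟨a, b, ha, hb, hab, rfl⟩
  rcases le_total a (1 / 2) with h | h
  · refine mem_iUnion.2 ⟨j, (2 * a) • q i + (2 * b - 1) • q j,
      ⟨2 * a, 2 * b - 1, by linarith, by linarith, by linarith, rfl⟩, ?_⟩
    rw [ifsMap]; module
  · refine mem_iUnion.2 ⟨i, (2 * a - 1) • q i + (2 * b) • q j,
      ⟨2 * a - 1, 2 * b, by linarith, by linarith, by linarith, rfl⟩, ?_⟩
    rw [ifsMap]; module

lemma vertex_mem_gasket (i : Fin (n + 1)) : q i ∈ gasket q :=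
  segment_subset_gasket q i i (left_mem_segment ℝ _ _)

/-- The barycentric coordinate of `x` with respect to the vertex `q i` of a unit simplex. -/
noncomputable def coord (i : Fin (n + 1)) (x : Pt n) : ℝ :=
  ((n : ℝ) + 1)⁻¹ * ∑ j, dist x (q j) ^ 2 - dist x (q i) ^ 2 + ((n : ℝ) + 1)⁻¹

lemma continuous_coord (i : Fin (n + 1)) : Continuous (coord q i) := by
  unfold coord; fun_prop

lemma sum_coord (x : Pt n) : ∑ i, coord q i x = 1 := by
  have : (n : ℝ) + 1 ≠ 0 := by positivity
  simp only [coord, Finset.sum_add_distrib, Finset.sum_sub_distrib, Finset.sum_const,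
    Finset.card_univ, Fintype.card_fin, nsmul_eq_mul]
  push_cast
  field_simp
  ring

/-- Stewart's identity. Its correction term does not depend on `w`, so it cancels in `coord`, which
is therefore affine although it is built from squared distances. -/
lemma dist_combo_sq {u v w : Pt n} {a b : ℝ} (hab : a + b = 1) : dist (a • u + b • v) w ^ 2 =
    a * dist u w ^ 2 + b * dist v w ^ 2 - a * b * dist u v ^ 2 := by
  have h1 : a • u + b • v - w = a • (u - w) + b • (v - w) := by
    have : w = a • w + b • w := by rw [← add_smul, hab, one_smul]
    conv_lhs => rw [this]
    module
  have h2 : u - v = (u - w) - (v - w) := by abel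
  obtain rfl : b = 1 - a := by linarith
  rw [dist_eq_norm, dist_eq_norm, dist_eq_norm, dist_eq_norm, h1, h2, norm_add_sq_real,
    norm_sub_sq_real (u - w) (v - w), norm_smul, norm_smul, real_inner_smul_left, real_inner_smul_right, mul_pow,
    mul_pow, Real.norm_eq_abs, Real.norm_eq_abs, sq_abs, sq_abs]
  ring

lemma coord_combo (i : Fin (n + 1)) {u v : Pt n} {a b : ℝ} (hab : a + b = 1) :
    coord q i (a • u + b • v) = a * coord q i u + b * coord q i v := by
  have hn : (n : ℝ) + 1 ≠ 0 := by positivity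
  simp only [coord, dist_combo_sq hab, Finset.sum_sub_distrib, Finset.sum_add_distrib,
    ← Finset.mul_sum, Finset.sum_const, Finset.card_univ, Fintype.card_fin, nsmul_eq_mul]
  obtain rfl : b = 1 - a := by linarith
  push_cast
  field_simp
  ring

variable {q}

lemma coord_vertex (hq : IsUnitSimplex q) (i k : Fin (n + 1)) :
    coord q i (q k) = if i = k then 1 else 0 := by
  have hd : ∀ j, dist (q k) (q j) ^ 2 = 1 - if j = k then 1 else 0 := by
    intro j
    split_ifs with h
    · simp [h]
    · simp [hq k j (Ne.symm h)]
  have hn : (n : ℝ) + 1 ≠ 0 := by positivity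
  simp only [coord, hd, Finset.sum_sub_distrib, Finset.sum_ite_eq', Finset.mem_univ, if_true,
    Finset.sum_const, Finset.card_univ, Fintype.card_fin, nsmul_eq_mul]
  push_cast
  field_simp
  split_ifs <;> ring

lemma coord_ifsMap (hq : IsUnitSimplex q) (i k : Fin (n + 1)) (x : Pt n) :
    coord q i (ifsMap q k x) = (coord q i x + if i = k then 1 else 0) / 2 := by
  rw [ifsMap, smul_add, coord_combo q i (by norm_num), coord_vertex hq]
  ring

lemma coord_nonneg (hq : IsUnitSimplex q) (i : Fin (n + 1)) {x : Pt n} (hx : x ∈ gasket q) :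
    0 ≤ coord q i x := by
  refine gasket_subset_of_forall_ifsMap q (P := {x | 0 ≤ coord q i x})
    (isClosed_le continuous_const (continuous_coord q i)) ⟨q i, vertex_mem_gasket q i, ?_⟩ ?_ hx
  · simp [coord_vertex hq]
  · intro k x _ h
    have h : 0 ≤ coord q i x := h
    simp only [mem_ofPred_eq, coord_ifsMap hq]
    split_ifs <;> linarith

lemma sum_coord_smul (hq : IsUnitSimplex q) {x : Pt n} (hx : x ∈ gasket q) :
    ∑ i, coord q i x • q i = x := by
  refine gasket_subset_of_forall_ifsMap q (P := {x | ∑ i, coord q i x • q i = x})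
    (isClosed_eq ?_ continuous_id) ⟨q 0, vertex_mem_gasket q 0, ?_⟩ ?_ hx
  · exact continuous_finsetSum _ fun i _ => (continuous_coord q i).smul continuous_const
  · simp [coord_vertex hq, ite_smul]
  · intro k x _ h
    have h : ∑ i, coord q i x • q i = x := h
    have : ∀ i, ((coord q i x + if i = k then 1 else 0) / 2) • q i =
        (1 / 2 : ℝ) • (coord q i x • q i) + (1 / 2 : ℝ) • (if i = k then q i else 0) := by
      intro i; split_ifs <;> module
    simp only [mem_ofPred_eq, coord_ifsMap hq, this, Finset.sum_add_distrib, ← Finset.smul_sum, h,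
      Finset.sum_ite_eq', Finset.mem_univ, if_true]
    rw [ifsMap, smul_add]

lemma coord_add_le_one (hq : IsUnitSimplex q) {i j : Fin (n + 1)} (hij : i ≠ j) {x : Pt n}
    (hx : x ∈ gasket q) : coord q i x + coord q j x ≤ 1 := by
  rw [← sum_coord q x, ← Finset.sum_pair (f := fun i => coord q i x) hij]
  exact Finset.sum_le_sum_of_subset_of_nonneg (Finset.subset_univ _)
    fun k _ _ => coord_nonneg hq k hx

lemma coord_le_one (hq : IsUnitSimplex q) (i : Fin (n + 1)) {x : Pt n} (hx : x ∈ gasket q) :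
    coord q i x ≤ 1 := by
  rw [← sum_coord q x]
  exact Finset.single_le_sum (f := fun i => coord q i x) (fun k _ => coord_nonneg hq k hx)
    (Finset.mem_univ i)

lemma eq_vertex_of_coord (hq : IsUnitSimplex q) {i : Fin (n + 1)} {x : Pt n} (hx : x ∈ gasket q)
    (h : 1 ≤ coord q i x) : x = q i := by
  have h1 : coord q i x = 1 := (coord_le_one hq i hx).antisymm h
  have h0 : ∀ j, j ≠ i → coord q j x = 0 := fun j hj => by
    have := coord_add_le_one hq hj hx
    have := coord_nonneg hq j hx
    linarith
  rw [← sum_coord_smul hq hx, Finset.sum_eq_single i (fun j _ hj => by rw [h0 j hj, zero_smul])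
    (fun h => absurd (Finset.mem_univ _) h), h1, one_smul]

/-- A point of the gasket lies on an edge if the other barycentric coordinates vanish. -/
lemma mem_segment_of_coord_eq_zero (hq : IsUnitSimplex q) {i j : Fin (n + 1)} {x : Pt n}
    (hx : x ∈ gasket q) (h : ∀ k, k ≠ i → k ≠ j → coord q k x = 0) :
    x ∈ segment ℝ (q i) (q j) := by
  rcases eq_or_ne i j with rfl | hij
  · have : x = q i := eq_vertex_of_coord hq hx <| by
      rw [← sum_coord q x]
      exact (Finset.sum_eq_single i (fun k _ hk => h k hk hk)
        (fun h => absurd (Finset.mem_univ _) h)).le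
    rw [this]
    exact left_mem_segment ℝ _ _
  refine ⟨coord q i x, coord q j x, coord_nonneg hq i hx, coord_nonneg hq j hx, ?_, ?_⟩
  · rw [← sum_coord q x, ← Finset.sum_pair (f := fun i => coord q i x) hij]
    refine Finset.sum_subset (Finset.subset_univ _) fun k _ hk => ?_
    simp only [Finset.mem_insert, Finset.mem_singleton, not_or] at hk
    exact h k hk.1 hk.2
  · conv_rhs => rw [← sum_coord_smul hq hx]
    rw [← Finset.sum_pair (f := fun i => coord q i x • q i) hij]
    refine Finset.sum_subset (Finset.subset_univ _) fun k _ hk => ?_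
    simp only [Finset.mem_insert, Finset.mem_singleton, not_or] at hk
    rw [h k hk.1 hk.2, zero_smul]

/-- The coordinates are nonnegative with sum one, so two of them that add up to one leave nothing
for the others. -/
lemma mem_segment_of_coord (hq : IsUnitSimplex q) {i j : Fin (n + 1)} (hij : i ≠ j) {x : Pt n}
    (hx : x ∈ gasket q) (h : 1 ≤ coord q i x + coord q j x) : x ∈ segment ℝ (q i) (q j) := by
  refine mem_segment_of_coord_eq_zero hq hx fun k hki hkj => ?_
  refine le_antisymm ?_ (coord_nonneg hq k hx)
  have := Finset.sum_le_sum_of_subset_of_nonneg (Finset.subset_univ {k, i, j})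
    fun l _ _ => coord_nonneg hq l hx
  rw [sum_coord, Finset.sum_insert (by simp [hki, hkj]), Finset.sum_pair hij] at this
  linarith

lemma coord_eq_zero_of_mem_segment (hq : IsUnitSimplex q) {i j k : Fin (n + 1)} {x : Pt n}
    (hx : x ∈ segment ℝ (q i) (q j)) (hki : k ≠ i) (hkj : k ≠ j) : coord q k x = 0 := by
  obtain ⟨a, b, -, -, hab, rfl⟩ := hx
  rw [coord_combo q k hab, coord_vertex hq, coord_vertex hq, if_neg hki, if_neg hkj, mul_zero,
    mul_zero, add_zero]

/-- Two cells of level one meet at most in one point. -/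
lemma eq_vertex_of_ifsMap_eq (hq : IsUnitSimplex q) {i k : Fin (n + 1)} (hik : i ≠ k) {a b : Pt n}
    (ha : a ∈ gasket q) (hb : b ∈ gasket q) (h : ifsMap q i a = ifsMap q k b) : a = q k := by
  refine eq_vertex_of_coord hq ha ?_
  have := congrArg (coord q k) h
  rw [coord_ifsMap hq, coord_ifsMap hq, if_neg hik.symm, if_pos rfl] at this
  linarith [coord_nonneg hq k hb]

lemma eq_of_ifsMap_eq_vertex (hq : IsUnitSimplex q) {j k : Fin (n + 1)} {z : Pt n}
    (hz : z ∈ gasket q) (h : ifsMap q j z = q k) : j = k := by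
  by_contra hjk
  have := congrArg (coord q k) h
  rw [coord_ifsMap hq, coord_vertex hq, if_neg (Ne.symm hjk), if_pos rfl] at this
  linarith [coord_le_one hq k hz]

end Coordinates

/-! ### Cells of arbitrary level and how they meet. -/

section Cells

variable {n : ℕ} (q : Fin (n + 1) → Pt n) (w : ℕ → Fin (n + 1))

/-- The map `F_{w 0} ∘ ⋯ ∘ F_{w (m-1)}`. -/
noncomputable def cellMap (m : ℕ) (z : Pt n) : Pt n :=
  (1 / 2 : ℝ) ^ m • z + ∑ k ∈ Finset.range m, (1 / 2 : ℝ) ^ (k + 1) • q (w k)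

lemma cellMap_zero (z : Pt n) : cellMap q w 0 z = z := by simp [cellMap]

lemma cellMap_succ (m : ℕ) (z : Pt n) :
    cellMap q w (m + 1) z = cellMap q w m (ifsMap q (w m) z) := by
  rw [cellMap, cellMap, ifsMap, Finset.sum_range_succ]
  module

lemma cellMap_one (z : Pt n) : cellMap q w 1 z = ifsMap q (w 0) z := by
  rw [cellMap_succ, cellMap_zero]

lemma continuous_cellMap (m : ℕ) : Continuous (cellMap q w m) := by
  unfold cellMap; fun_prop

lemma dist_cellMap (m : ℕ) (x y : Pt n) :
    dist (cellMap q w m x) (cellMap q w m y) = (1 / 2 : ℝ) ^ m * dist x y := by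
  simp [cellMap, dist_eq_norm, ← smul_sub, norm_smul]

lemma cellMap_injective (m : ℕ) : Function.Injective (cellMap q w m) := by
  intro x y h
  have := dist_cellMap q w m x y
  rw [h, dist_self] at this
  exact dist_eq_zero.1 ((mul_eq_zero.1 this.symm).resolve_left (by positivity))

lemma cellMap_combo (m : ℕ) {a b : ℝ} (hab : a + b = 1) (x y : Pt n) :
    cellMap q w m (a • x + b • y) = a • cellMap q w m x + b • cellMap q w m y := by
  obtain rfl : b = 1 - a := by linarith
  simp only [cellMap]
  module

lemma image_cellMap_segment (m : ℕ) (x y : Pt n) :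
    cellMap q w m '' segment ℝ x y = segment ℝ (cellMap q w m x) (cellMap q w m y) := by
  ext z
  constructor
  · rintro ⟨_, ⟨a, b, ha, hb, hab, rfl⟩, rfl⟩
    exact ⟨a, b, ha, hb, hab, (cellMap_combo q w m hab x y).symm⟩
  · rintro ⟨a, b, ha, hb, hab, rfl⟩
    exact ⟨_, ⟨a, b, ha, hb, hab, rfl⟩, cellMap_combo q w m hab x y⟩

lemma cellMap_mem_gasket (m : ℕ) {z : Pt n} (hz : z ∈ gasket q) : cellMap q w m z ∈ gasket q := by
  induction m generalizing z with
  | zero => rwa [cellMap_zero]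
  | succ m ih => rw [cellMap_succ]; exact ih (ifsMap_mem_gasket q _ hz)

lemma image_cellMap_subset_gasket (m : ℕ) : cellMap q w m '' gasket q ⊆ gasket q := by
  rintro _ ⟨z, hz, rfl⟩
  exact cellMap_mem_gasket q w m hz

lemma cellMap_addressPt (m : ℕ) : cellMap q w m (addressPt q fun k => w (k + m)) = addressPt q w := by
  induction m with
  | zero => simp [cellMap_zero]
  | succ m ih =>
    rw [cellMap_succ, ← ih, addressPt_eq q fun k => w (k + m)]
    simp only [zero_add, add_right_comm _ 1 m, add_assoc]

lemma cellMap_mem_vertexLevel (m k : ℕ) {z : Pt n} (hz : z ∈ vertexLevel q k) :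
    cellMap q w m z ∈ vertexLevel q (k + m) := by
  induction m generalizing z k with
  | zero => rwa [cellMap_zero]
  | succ m ih =>
    rw [cellMap_succ, ← add_assoc, add_right_comm]
    exact ih (k + 1) (mem_iUnion.2 ⟨_, mem_image_of_mem _ hz⟩)

lemma cellMap_mem_vertices (m : ℕ) (i : Fin (n + 1)) : cellMap q w m (q i) ∈ vertices q :=
  mem_iUnion.2 ⟨0 + m, cellMap_mem_vertexLevel q w m 0 (mem_range_self i)⟩

lemma countable_vertices : (vertices q).Countable := by
  refine countable_iUnion fun m => ?_
  induction m with
  | zero => exact countable_range q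
  | succ m ih => exact countable_iUnion fun i => ih.image _

lemma isClosed_iUnion_image_ifsMap (T : Set (Fin (n + 1))) :
    IsClosed (⋃ l ∈ T, ifsMap q l '' gasket q) :=
  T.toFinite.isClosed_biUnion fun l _ =>
    ((isCompact_gasket q).image (continuous_ifsMap q l)).isClosed

/-- Curves in a cell are scaled copies of curves in the gasket. -/
lemma le_hausdorffMeasure_of_cell {m : ℕ} {a b : Pt n} {c : ℝ}
    (h : ∀ R ⊆ gasket q, JoinedIn R a b → ENNReal.ofReal c ≤ μH[1] R) {R : Set (Pt n)}
    (hR : R ⊆ cellMap q w m '' gasket q)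
    (hj : JoinedIn R (cellMap q w m a) (cellMap q w m b)) :
    ENNReal.ofReal ((1 / 2) ^ m * c) ≤ μH[1] R := by
  -- The inverse of the cell map. It is Lipschitz with constant `2 ^ m`, which gives the scaling
  -- factor.
  set g : Pt n → Pt n := fun x =>
    (2 : ℝ) ^ m • (x - ∑ k ∈ Finset.range m, (1 / 2 : ℝ) ^ (k + 1) • q (w k)) with hg
  have hgc : Continuous g := by rw [hg]; fun_prop
  have hgf : ∀ x, g (cellMap q w m x) = x := by
    intro x
    simp only [hg, cellMap, add_sub_cancel_right, smul_smul, ← mul_pow]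
    norm_num
  have hgl : LipschitzWith (2 ^ m) g := by
    refine LipschitzWith.of_dist_le_mul fun x y => ?_
    simp [hg, dist_eq_norm, ← smul_sub, norm_smul]
  have hsub : g '' R ⊆ gasket q := by
    rintro _ ⟨x, hx, rfl⟩
    obtain ⟨z, hz, rfl⟩ := hR hx
    rwa [hgf]
  have h1 := hj.map hgc
  rw [hgf, hgf] at h1
  have h2 := (h _ hsub h1).trans (hgl.hausdorffMeasure_image_le zero_le_one R)
  rw [ENNReal.rpow_one] at h2
  rw [ENNReal.ofReal_mul (by positivity)]
  calc ENNReal.ofReal ((1 / 2) ^ m) * ENNReal.ofReal c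
      ≤ ENNReal.ofReal ((1 / 2) ^ m) * (((2 ^ m : ℝ≥0) : ℝ≥0∞) * μH[1] R) := by gcongr
    _ = μH[1] R := by
        rw [← mul_assoc, ← ENNReal.ofReal_coe_nnreal, ← ENNReal.ofReal_mul (by positivity)]
        push_cast
        rw [← mul_pow]
        norm_num

variable {q}

lemma exists_eq_of_mem_inter (hq : IsUnitSimplex q) {k : Fin (n + 1)} {T : Set (Fin (n + 1))}
    (hk : k ∉ T) {x : Pt n} (hx : x ∈ ifsMap q k '' gasket q)
    (hxT : x ∈ ⋃ l ∈ T, ifsMap q l '' gasket q) :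
    ∃ l ∈ T, x = ifsMap q k (q l) ∧ x = ifsMap q l (q k) := by
  obtain ⟨a, ha, rfl⟩ := hx
  simp only [mem_iUnion] at hxT
  obtain ⟨l, hl, b, hb, hab⟩ := hxT
  have hlk : l ≠ k := fun h => hk (h ▸ hl)
  refine ⟨l, hl, ?_, ?_⟩
  · rw [eq_vertex_of_ifsMap_eq hq hlk.symm ha hb hab.symm]
  · rw [← hab, eq_vertex_of_ifsMap_eq hq hlk hb ha hab]

/-- A cell is separated from the rest of the gasket by its corners. -/
lemma exists_cell_complement (hq : IsUnitSimplex q) (m : ℕ) :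
    ∃ D, IsClosed D ∧ gasket q ⊆ cellMap q w m '' gasket q ∪ D ∧
      ∀ x ∈ cellMap q w m '' gasket q, x ∈ D → ∃ i, x = cellMap q w m (q i) := by
  induction m with
  | zero =>
    refine ⟨∅, isClosed_empty, fun x hx => Or.inl ⟨x, hx, cellMap_zero q w x⟩, ?_⟩
    exact fun x _ h => h.elim
  | succ m ih =>
    obtain ⟨D, hD, hcover, hint⟩ := ih
    have hsucc : cellMap q w (m + 1) = cellMap q w m ∘ ifsMap q (w m) :=
      funext fun z => cellMap_succ q w m z
    refine ⟨D ∪ cellMap q w m '' ⋃ l ∈ {l | l ≠ w m}, ifsMap q l '' gasket q, hD.union ?_, ?_, ?_⟩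
    · refine IsCompact.isClosed (IsCompact.image ?_ (continuous_cellMap q w m))
      exact Set.toFinite _ |>.isCompact_biUnion fun l _ =>
        (isCompact_gasket q).image (continuous_ifsMap q l)
    · intro x hx
      rcases hcover hx with ⟨y, hy, rfl⟩ | hx
      · rw [gasket_eq_iUnion] at hy
        obtain ⟨l, z, hz, rfl⟩ := mem_iUnion.1 hy
        by_cases hl : l = w m
        · exact Or.inl ⟨z, hz, by rw [hsucc, hl]; rfl⟩
        · exact Or.inr (Or.inr ⟨_, mem_biUnion (show l ∈ {l | l ≠ w m} from hl) ⟨z, hz, rfl⟩, rfl⟩)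
      · exact Or.inr (Or.inl hx)
    · rintro _ ⟨z, hz, rfl⟩ (hxD | ⟨y, hy, hyx⟩)
      · rw [cellMap_succ] at hxD ⊢
        obtain ⟨i, hi⟩ := hint _ (mem_image_of_mem _ (ifsMap_mem_gasket q (w m) hz)) hxD
        have hi' := cellMap_injective q w m hi
        -- A corner of the parent cell that lies in the child must have the index `w m`; as `F_i`
        -- fixes `q i`, it is also a corner of the child.
        have := eq_of_ifsMap_eq_vertex hq hz hi'
        refine ⟨i, ?_⟩
        rw [cellMap_succ, hi', this, ifsMap_vertex]
      · rw [cellMap_succ] at hyx ⊢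
        have hy' := cellMap_injective q w m hyx
        obtain ⟨l, -, h, -⟩ := exists_eq_of_mem_inter hq (k := w m) (T := {l | l ≠ w m})
          (fun h => h rfl) ⟨z, hz, rfl⟩ (hy' ▸ hy)
        exact ⟨l, by rw [cellMap_succ, h]⟩

end Cells

/-! ### Length of paths that start at a vertex. -/

section LowerBound

variable {n : ℕ} {q : Fin (n + 1) → Pt n}

lemma ofReal_half_le (hq : IsUnitSimplex q) {k i l : Fin (n + 1)} (hil : i ≠ l) {K : Set (Pt n)}
    (hK : IsPreconnected K) (hi : ifsMap q k (q i) ∈ K) (hl : ifsMap q k (q l) ∈ K) :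
    ENNReal.ofReal (1 / 2) ≤ μH[1] K := by
  have := ofReal_dist_le_hausdorffMeasure hK hi hl
  rwa [dist_ifsMap, hq i l hil, mul_one] at this

lemma gasket_subset_union (i : Fin (n + 1)) :
    gasket q ⊆ ifsMap q i '' gasket q ∪ ⋃ l ∈ {l | l ≠ i}, ifsMap q l '' gasket q := by
  intro x hx
  rw [gasket_eq_iUnion] at hx
  obtain ⟨l, hl⟩ := mem_iUnion.1 hx
  by_cases h : l = i
  · exact Or.inl (h ▸ hl)
  · exact Or.inr (mem_biUnion (show l ∈ {l | l ≠ i} from h) hl)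

/-- A path that starts in `F_k(S)` and stays in the union of the `F_l(S)`, `l ∈ T`, and `F_k(S)`,
either is scaled from a path in `S` or has length at least `1 / 2`. -/
lemma le_hausdorffMeasure_of_start (hq : IsUnitSimplex q) {k i : Fin (n + 1)}
    {T : Set (Fin (n + 1))} (hk : k ∉ T) (hi : i ∉ T) {R : Set (Pt n)} {y : Pt n} {c : ℝ}
    (hR : R ⊆ ifsMap q k '' gasket q ∪ ⋃ l ∈ T, ifsMap q l '' gasket q)
    (hj : JoinedIn R (ifsMap q k (q i)) y) (hc : c ≤ 1 / 2)
    (h : ∀ z ∈ gasket q, y = ifsMap q k z → ∀ R ⊆ gasket q, JoinedIn R (q i) z →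
      ENNReal.ofReal (2 * c) ≤ μH[1] R) :
    ENNReal.ofReal c ≤ μH[1] R := by
  obtain ⟨K, hKR, hK, hKi, hKy⟩ := exists_isPathConnected_of_joinedIn hj
  refine le_trans ?_ (measure_mono hKR)
  have hKp := hK.isConnected.isPreconnected
  by_cases hKC : K ⊆ ifsMap q k '' gasket q
  · obtain ⟨z, hz, rfl⟩ := hKC hKy
    have hcell : cellMap q (fun _ => k) 1 = ifsMap q k := funext fun z => cellMap_one q _ z
    have := le_hausdorffMeasure_of_cell q (fun _ => k) (m := 1) (h z hz rfl) (R := K)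
      (by rwa [hcell]) (by rw [hcell]; exact hK.joinedIn _ hKi _ hKy)
    rwa [show (1 / 2 : ℝ) ^ 1 * (2 * c) = c by ring] at this
  -- A path that leaves `F_k(S)` passes a corner `F_k(q_l)` with `l ∈ T`. Since `i ∉ T`, this is not
  -- the starting corner, and the two are `1 / 2` apart.
  · obtain ⟨b, hbK, hb⟩ := not_subset.1 hKC
    obtain ⟨x, hxK, hxC, hxD⟩ := isPreconnected_closed_iff.1 hKp _ _
      ((isCompact_gasket q).image (continuous_ifsMap q k)).isClosed
      (isClosed_iUnion_image_ifsMap q T) (hKR.trans hR)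
      ⟨_, hKi, mem_image_of_mem _ (vertex_mem_gasket q i)⟩
      ⟨b, hbK, (hR (hKR hbK)).resolve_left hb⟩
    obtain ⟨l, hl, rfl, -⟩ := exists_eq_of_mem_inter hq hk hxC hxD
    exact (ENNReal.ofReal_le_ofReal hc).trans
      (ofReal_half_le hq (ne_of_mem_of_not_mem hl hi).symm hKp hKi hxK)

/-- The error `(1 / 2) ^ m` makes the bound trivial for `m = 0` and is halved whenever a path is
rescaled from a cell of level one. If `y` lies outside `F_i(S)`, the path first needs length `1 / 2`
to reach a corner `F_i(q_k) = F_k(q_i)`, and the rest of it starts at the vertex of `F_k(S)` that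
corresponds to `q i`. -/
lemma ofReal_sub_pow_le (hq : IsUnitSimplex q) (m : ℕ) (i : Fin (n + 1)) {y : Pt n}
    (hy : y ∈ gasket q) {R : Set (Pt n)} (hR : R ⊆ gasket q) (hj : JoinedIn R (q i) y) :
    ENNReal.ofReal (1 - coord q i y - (1 / 2) ^ m) ≤ μH[1] R := by
  induction m generalizing y R with
  | zero =>
    rw [ENNReal.ofReal_of_nonpos]
    · exact zero_le
    · have := coord_nonneg hq i hy
      rw [pow_zero]; linarith
  | succ m ih =>
    have hCcl : IsClosed (ifsMap q i '' gasket q) :=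
      ((isCompact_gasket q).image (continuous_ifsMap q i)).isClosed
    have hpow : (0 : ℝ) < (1 / 2) ^ m := by positivity
    by_cases hyC : y ∈ ifsMap q i '' gasket q
    · rw [← ifsMap_vertex q i] at hj
      refine le_hausdorffMeasure_of_start hq (T := {l | l ≠ i}) (fun h => h rfl) (fun h => h rfl)
        (hR.trans (gasket_subset_union i)) hj ?_ ?_
      · obtain ⟨z, hz, rfl⟩ := hyC
        have := coord_nonneg hq i hz
        rw [coord_ifsMap hq, if_pos rfl, pow_succ]
        linarith
      · rintro z hz rfl R' hR' hj'
        convert ih hz hR' hj' using 2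
        rw [coord_ifsMap hq, if_pos rfl, pow_succ]
        ring
    · have hD := isClosed_iUnion_image_ifsMap q {l | l ≠ i}
      have hsub := hR.trans (gasket_subset_union i)
      have hfin : ((⋃ l ∈ {l | l ≠ i}, ifsMap q l '' gasket q) ∩ ifsMap q i '' gasket q).Finite := by
        refine (finite_range fun l => ifsMap q i (q l)).subset ?_
        rintro x ⟨hxD, hxC⟩
        obtain ⟨l, -, h, -⟩ := exists_eq_of_mem_inter hq (T := {l | l ≠ i}) (fun h => h rfl) hxC hxD
        exact ⟨l, h.symm⟩
      obtain ⟨u, ⟨huD, huC⟩, R₁, hR₁, R₂, hR₂, hc, hj₁, hj₂, hu⟩ := exists_split_of_joinedIn hj hD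
        hCcl (by rwa [union_comm]) hfin ⟨q i, vertex_mem_gasket q i, ifsMap_vertex q i⟩
        ((gasket_subset_union i hy).resolve_left hyC)
      obtain ⟨k, hki, rfl, huk⟩ :=
        exists_eq_of_mem_inter hq (T := {l | l ≠ i}) (fun h => h rfl) huC huD
      refine le_trans ?_ (hausdorffMeasure_add_le hR₁ (hR₂.trans inter_subset_left) hc hu)
      have h1 : ENNReal.ofReal (1 / 2) ≤ μH[1] R₁ := by
        have := ofReal_dist_le_of_joinedIn hj₁
        nth_rewrite 1 [← ifsMap_vertex q i] at this
        rwa [dist_ifsMap, hq i k (Ne.symm hki), mul_one] at this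
      have h2 : ENNReal.ofReal (1 / 2 - coord q i y - (1 / 2) ^ (m + 1)) ≤ μH[1] R₂ := by
        rw [huk] at hj₂
        -- The second piece avoids `F_i(S)` except at corners shared with other cells, so `i` can be
        -- left out of `T`. Otherwise the exit from `F_k(S)` could be the starting corner, which
        -- yields no length.
        refine le_hausdorffMeasure_of_start hq (T := {l | l ≠ k ∧ l ≠ i}) (fun h => h.1 rfl)
          (fun h => h.2 rfl) ?_ hj₂ ?_ ?_
        · intro x hx
          have := (hR₂ hx).2
          simp only [mem_iUnion] at this
          obtain ⟨l, hl, hx⟩ := this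
          by_cases hlk : l = k
          · exact Or.inl (hlk ▸ hx)
          · exact Or.inr (mem_biUnion (show l ∈ {l | l ≠ k ∧ l ≠ i} from ⟨hlk, hl⟩) hx)
        · have := coord_nonneg hq i hy
          rw [pow_succ]; linarith
        · rintro z hz rfl R' hR' hj'
          convert ih hz hR' hj' using 2
          rw [coord_ifsMap hq, if_neg (Ne.symm hki), pow_succ]
          ring
      refine le_trans ?_ (add_le_add h1 h2)
      refine le_trans (ENNReal.ofReal_le_ofReal ?_) ENNReal.ofReal_add_le
      linarith

/-- A path in the gasket from a vertex `q i` to `y` has at least the length `1 - y_i`. -/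
lemma ofReal_one_sub_coord_le (hq : IsUnitSimplex q) (i : Fin (n + 1)) {y : Pt n}
    (hy : y ∈ gasket q) {R : Set (Pt n)} (hR : R ⊆ gasket q) (hj : JoinedIn R (q i) y) :
    ENNReal.ofReal (1 - coord q i y) ≤ μH[1] R := by
  have h : Filter.Tendsto (fun m : ℕ => ENNReal.ofReal (1 - coord q i y - (1 / 2) ^ m))
      Filter.atTop (nhds (ENNReal.ofReal (1 - coord q i y - 0))) :=
    (ENNReal.continuous_ofReal.tendsto _).comp (tendsto_const_nhds.sub
      (tendsto_pow_atTop_nhds_zero_of_lt_one (by norm_num) (by norm_num)))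
  rw [sub_zero] at h
  exact le_of_tendsto' h fun m => ofReal_sub_pow_le hq m i hy hR hj

end LowerBound

/-! ### Curves of finite length from a vertex to any point of the gasket. -/

section RectifiableCurve

/-- The part of `[0, s]` in the interval `[1 - 2⁻ᵏ, 1 - 2⁻ᵏ⁻¹]`, measured by its length. -/
noncomputable def ramp (k : ℕ) (s : ℝ) : ℝ :=
  min s (1 - (1 / 2) ^ (k + 1)) - min s (1 - (1 / 2) ^ k)

lemma ramp_mono (k : ℕ) : Monotone (ramp k) := by
  intro s t hst
  have : (0 : ℝ) < (1 / 2) ^ k := by positivity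
  unfold ramp
  rw [pow_succ]
  grind

lemma ramp_zero_right (k : ℕ) : ramp k 0 = 0 := by
  have h : (1 / 2 : ℝ) ^ (k + 1) ≤ 1 := pow_le_one₀ (by norm_num) (by norm_num)
  have h' : (1 / 2 : ℝ) ^ k ≤ 1 := pow_le_one₀ (by norm_num) (by norm_num)
  rw [ramp, min_eq_left (by linarith), min_eq_left (by linarith), sub_zero]

lemma ramp_nonneg (k : ℕ) {s : ℝ} (hs : 0 ≤ s) : 0 ≤ ramp k s :=
  (ramp_zero_right k).symm.le.trans (ramp_mono k hs)

lemma ramp_one (k : ℕ) : ramp k 1 = (1 / 2) ^ (k + 1) := by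
  have h : (0 : ℝ) < (1 / 2) ^ (k + 1) := by positivity
  have h' : (0 : ℝ) < (1 / 2) ^ k := by positivity
  rw [ramp, min_eq_right (by linarith), min_eq_right (by linarith), pow_succ]
  ring

lemma hasSum_ramp {s : ℝ} (h0 : 0 ≤ s) (h1 : s ≤ 1) : HasSum (fun k => ramp k s) s := by
  rw [hasSum_iff_tendsto_nat_of_nonneg fun k => ramp_nonneg k h0]
  simp only [ramp, Finset.sum_range_sub (fun k => min s (1 - (1 / 2 : ℝ) ^ k)), pow_zero,
    sub_self, min_eq_right h0, sub_zero]
  have : Filter.Tendsto (fun m : ℕ => min s (1 - (1 / 2 : ℝ) ^ m)) Filter.atTop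
      (nhds (min s (1 - 0))) := tendsto_const_nhds.min (tendsto_const_nhds.sub
    (tendsto_pow_atTop_nhds_zero_of_lt_one (by norm_num) (by norm_num)))
  rwa [sub_zero, min_eq_left h1] at this

lemma ramp_zero_of_le {s : ℝ} (h0 : 0 ≤ s) (h : s ≤ 1 / 2) : ramp 0 s = s := by
  norm_num [ramp, min_eq_left h, min_eq_right h0]

lemma ramp_succ_of_le (k : ℕ) {s : ℝ} (h : s ≤ 1 / 2) : ramp (k + 1) s = 0 := by
  have h1 : (1 / 2 : ℝ) ^ k ≤ 1 := pow_le_one₀ (by norm_num) (by norm_num)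
  have h0 : (0 : ℝ) < (1 / 2) ^ k := by positivity
  rw [ramp, pow_succ, pow_succ, min_eq_left (by linarith), min_eq_left (by linarith), sub_self]

lemma ramp_zero_of_ge {s : ℝ} (h : 1 / 2 ≤ s) : ramp 0 s = 1 / 2 := by
  have : min s 0 = 0 := min_eq_right (by linarith)
  have : min s (1 / 2) = 1 / 2 := min_eq_right h
  norm_num [ramp, *]

/-- The map `s ↦ 2 * s - 1` takes each dyadic interval to its predecessor. This makes the second
half of `addressCurve` a scaled copy of the curve for the shifted address. -/
lemma ramp_succ_eq (k : ℕ) (s : ℝ) : ramp (k + 1) s = 1 / 2 * ramp k (2 * s - 1) := by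
  unfold ramp
  simp only [pow_succ]
  grind

variable {n : ℕ} (q : Fin (n + 1) → Pt n)

/-- A curve of speed at most one that joins the vertex `q 0` to the point with address `w`. -/
noncomputable def addressCurve (w : ℕ → Fin (n + 1)) (s : ℝ) : Pt n :=
  q 0 + ∑' k, ramp k s • (q (w k) - q 0)

variable {q}

lemma norm_sub_le_one (hq : IsUnitSimplex q) (i j : Fin (n + 1)) : ‖q i - q j‖ ≤ 1 := by
  rw [← dist_eq_norm]
  rcases eq_or_ne i j with rfl | h
  · simp
  · exact (hq i j h).le

lemma summable_ramp_smul (hq : IsUnitSimplex q) (w : ℕ → Fin (n + 1)) {s : ℝ} (h0 : 0 ≤ s)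
    (h1 : s ≤ 1) : Summable fun k => ramp k s • (q (w k) - q 0) := by
  refine Summable.of_norm_bounded (hasSum_ramp h0 h1).summable fun k => ?_
  rw [norm_smul, Real.norm_of_nonneg (ramp_nonneg k h0)]
  exact mul_le_of_le_one_right (ramp_nonneg k h0) (norm_sub_le_one hq _ _)

lemma dist_addressCurve_le (hq : IsUnitSimplex q) (w : ℕ → Fin (n + 1)) {s t : ℝ} (h0 : 0 ≤ s)
    (hst : s ≤ t) (h1 : t ≤ 1) : dist (addressCurve q w s) (addressCurve q w t) ≤ t - s := by
  rw [dist_comm, dist_eq_norm, addressCurve, addressCurve, add_sub_add_left_eq_sub,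
    ← (summable_ramp_smul hq w (h0.trans hst) h1).tsum_sub
      (summable_ramp_smul hq w h0 (hst.trans h1))]
  refine tsum_of_norm_bounded
    ((hasSum_ramp (h0.trans hst) h1).sub (hasSum_ramp h0 (hst.trans h1))) fun k => ?_
  have hm : 0 ≤ ramp k t - ramp k s := sub_nonneg.2 (ramp_mono k hst)
  rw [← sub_smul, norm_smul, Real.norm_of_nonneg hm]
  exact mul_le_of_le_one_right hm (norm_sub_le_one hq _ _)

lemma lipschitzOnWith_addressCurve (hq : IsUnitSimplex q) (w : ℕ → Fin (n + 1)) :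
    LipschitzOnWith 1 (addressCurve q w) (Icc 0 1) := by
  refine LipschitzOnWith.of_dist_le_mul fun s hs t ht => ?_
  rw [NNReal.coe_one, one_mul]
  rcases le_total s t with h | h
  · rw [Real.dist_eq, abs_sub_comm, abs_of_nonneg (sub_nonneg.2 h)]
    exact dist_addressCurve_le hq w hs.1 h ht.2
  · rw [dist_comm, Real.dist_eq, abs_of_nonneg (sub_nonneg.2 h)]
    exact dist_addressCurve_le hq w ht.1 h hs.2

lemma addressCurve_zero (w : ℕ → Fin (n + 1)) : addressCurve q w 0 = q 0 := by
  simp [addressCurve, ramp_zero_right]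

lemma addressCurve_one (w : ℕ → Fin (n + 1)) : addressCurve q w 1 = addressPt q w := by
  have h : HasSum (fun k : ℕ => (1 / 2 : ℝ) ^ (k + 1)) 1 := by
    simpa only [ramp_one] using hasSum_ramp zero_le_one le_rfl
  simp only [addressCurve, ramp_one, smul_sub, addressPt]
  rw [(summable_term q w).tsum_sub (h.smul_const (q 0)).summable, (h.smul_const (q 0)).tsum_eq]
  simp

lemma addressCurve_of_le (w : ℕ → Fin (n + 1)) {s : ℝ} (h0 : 0 ≤ s) (h : s ≤ 1 / 2) :
    addressCurve q w s = (1 - s) • q 0 + s • q (w 0) := by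
  rw [addressCurve, tsum_eq_single 0, ramp_zero_of_le h0 h]
  · module
  · intro k hk
    obtain ⟨k, rfl⟩ := Nat.exists_eq_succ_of_ne_zero hk
    rw [Nat.succ_eq_add_one, ramp_succ_of_le k h, zero_smul]

lemma addressCurve_of_ge (hq : IsUnitSimplex q) (w : ℕ → Fin (n + 1)) {s : ℝ} (h : 1 / 2 ≤ s)
    (h1 : s ≤ 1) : addressCurve q w s =
      ifsMap q (w 0) (addressCurve q (fun k => w (k + 1)) (2 * s - 1)) := by
  rw [addressCurve, (summable_ramp_smul hq w (by linarith) h1).tsum_eq_zero_add,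
    ramp_zero_of_ge h, ifsMap, addressCurve]
  simp only [ramp_succ_eq, mul_smul]
  rw [tsum_const_smul'']
  module

lemma addressCurve_mem_gasket (hq : IsUnitSimplex q) (w : ℕ → Fin (n + 1)) {s : ℝ}
    (hs : s ∈ Icc (0 : ℝ) 1) : addressCurve q w s ∈ gasket q := by
  rcases hs.2.eq_or_lt with rfl | hlt
  · exact ⟨w, (addressCurve_one w).symm⟩
  -- For `s < 1` finitely many rescalings `s ↦ 2 * s - 1` bring the parameter into the first half,
  -- where the curve runs along an edge.
  obtain ⟨m, hm⟩ := exists_pow_lt_of_lt_one (sub_pos.2 hlt) (show (1 / 2 : ℝ) < 1 by norm_num)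
  replace hm : s ≤ 1 - (1 / 2) ^ m := by linarith
  have h0 := hs.1
  clear hs hlt
  induction m generalizing w s with
  | zero =>
    obtain rfl : s = 0 := le_antisymm (by simpa using hm) h0
    rw [addressCurve_zero]
    exact vertex_mem_gasket q 0
  | succ m ih =>
    have hp : (0 : ℝ) < (1 / 2) ^ m := by positivity
    rw [pow_succ] at hm
    rcases le_total s (1 / 2) with h | h
    · rw [addressCurve_of_le w h0 h]
      exact segment_subset_gasket q 0 (w 0) ⟨1 - s, s, by linarith, h0, by ring, rfl⟩
    · rw [addressCurve_of_ge hq w h (by linarith)]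
      exact ifsMap_mem_gasket q _ (ih _ (by linarith) (by linarith))

end RectifiableCurve

/-! ### The intrinsic distance and its geodesics. -/

section LengthDistance

variable {n : ℕ} (q : Fin (n + 1) → Pt n)

/-- The infimum of the lengths of the path-connected parts of the gasket that join `a` to `b`. -/
noncomputable def lengthDist (a b : Pt n) : ℝ≥0∞ :=
  ⨅ (R : Set (Pt n)) (_ : R ⊆ gasket q) (_ : JoinedIn R a b), μH[1] R

lemma intrinsicDist_eq (a b : Pt n) : intrinsicDist q a b = (lengthDist q a b).toReal := by
  rw [intrinsicDist]
  congr 1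
  refine le_antisymm ?_ ?_
  · refine le_iInf₂ fun R hR => le_iInf fun hj => ?_
    obtain ⟨γ, hγ⟩ := hj
    exact (iInf₂_le γ fun s => hR (hγ s)).trans (measure_mono (range_subset_iff.2 hγ))
  · refine le_iInf₂ fun γ hγ => ?_
    exact iInf₂_le_of_le (range γ) (range_subset_iff.2 hγ) (iInf_le _ ⟨γ, mem_range_self⟩)

variable {q}

lemma lengthDist_le {R : Set (Pt n)} (hR : R ⊆ gasket q) {a b : Pt n} (h : JoinedIn R a b) :
    lengthDist q a b ≤ μH[1] R :=
  iInf₂_le_of_le R hR (iInf_le _ h)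

lemma lengthDist_comm (a b : Pt n) : lengthDist q a b = lengthDist q b a :=
  le_antisymm (le_iInf₂ fun _ hR => le_iInf fun hj => lengthDist_le hR hj.symm)
    (le_iInf₂ fun _ hR => le_iInf fun hj => lengthDist_le hR hj.symm)

/-- With path images relaxed to sets in which the end points are joined, concatenation is just a
union. The subtractions serve to treat the two infima one at a time. -/
lemma lengthDist_triangle (a b c : Pt n) :
    lengthDist q a c ≤ lengthDist q a b + lengthDist q b c := by
  rw [← tsub_le_iff_right]
  refine le_iInf₂ fun R hR => le_iInf fun hj => ?_
  rw [tsub_le_iff_right, ← tsub_le_iff_left]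
  refine le_iInf₂ fun R' hR' => le_iInf fun hj' => ?_
  rw [tsub_le_iff_left]
  exact (lengthDist_le (union_subset hR hR') ((hj.mono subset_union_left).trans
    (hj'.mono subset_union_right))).trans (measure_union_le _ _)

lemma ofReal_dist_le_lengthDist (a b : Pt n) : ENNReal.ofReal (dist a b) ≤ lengthDist q a b :=
  le_iInf₂ fun _ _ => le_iInf fun h => ofReal_dist_le_of_joinedIn h

lemma lengthDist_self {a : Pt n} (ha : a ∈ gasket q) : lengthDist q a a = 0 := by
  have := Measure.nullSingletonClass_hausdorff (Pt n) (d := 1) one_pos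
  refine le_antisymm ((lengthDist_le (R := {a}) (by simpa using ha) (.refl rfl)).trans ?_) zero_le
  rw [measure_singleton]

/-- Finiteness matters because `toReal` would turn an infinite distance into `0`. Each point is
joined to `q 0` by an `addressCurve` of length at most one. -/
lemma lengthDist_lt_top (hq : IsUnitSimplex q) {a b : Pt n} (ha : a ∈ gasket q)
    (hb : b ∈ gasket q) : lengthDist q a b < ∞ := by
  have key : ∀ x ∈ gasket q, lengthDist q (q 0) x ≤ 1 := by
    rintro _ ⟨w, rfl⟩
    have hl := lipschitzOnWith_addressCurve hq w
    have hj : JoinedIn (addressCurve q w '' Icc 0 1) (q 0) (addressPt q w) :=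
      JoinedIn.ofLine hl.continuousOn (addressCurve_zero w) (addressCurve_one w) subset_rfl
    refine (lengthDist_le ?_ hj).trans ((hl.hausdorffMeasure_image_le zero_le_one).trans ?_)
    · rintro _ ⟨s, hs, rfl⟩
      exact addressCurve_mem_gasket hq w hs
    · simp [hausdorffMeasure_real]
  calc lengthDist q a b ≤ lengthDist q a (q 0) + lengthDist q (q 0) b := lengthDist_triangle _ _ _
    _ ≤ 1 + 1 := add_le_add (lengthDist_comm (q := q) a _ ▸ key a ha) (key b hb)
    _ < ∞ := by norm_num

lemma lengthDist_cell_corners (w : ℕ → Fin (n + 1)) (m : ℕ)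
    (i j : Fin (n + 1)) : lengthDist q (cellMap q w m (q i)) (cellMap q w m (q j)) ≤
      ENNReal.ofReal ((1 / 2) ^ m * dist (q i) (q j)) := by
  rw [← dist_cellMap q w m, ← edist_dist, ← hausdorffMeasure_segment]
  refine lengthDist_le ?_ (((convex_segment _ _).isPathConnected ⟨_, left_mem_segment ℝ _ _⟩).joinedIn
    _ (left_mem_segment ℝ _ _) _ (right_mem_segment ℝ _ _))
  rw [← image_cellMap_segment]
  exact (image_mono (segment_subset_gasket q i j)).trans (image_cellMap_subset_gasket q w m)

/-- A point outside a cell reaches a point of the cell through one of its corners. -/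
lemma exists_corner_add_le (hq : IsUnitSimplex q) (w : ℕ → Fin (n + 1)) (m : ℕ) {a y : Pt n}
    (ha : a ∈ gasket q) (hac : a ∉ cellMap q w m '' gasket q) (hy : y ∈ gasket q) :
    ∃ i, lengthDist q a (cellMap q w m (q i)) + ENNReal.ofReal ((1 / 2) ^ m * (1 - coord q i y)) ≤
      lengthDist q a (cellMap q w m y) := by
  -- The entrance corner depends on the path. A corner that minimizes the bound serves all paths at
  -- once.
  obtain ⟨i₀, hi₀⟩ := Finite.exists_min fun i => lengthDist q a (cellMap q w m (q i)) +
    ENNReal.ofReal ((1 / 2) ^ m * (1 - coord q i y))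
  refine ⟨i₀, le_iInf₂ fun R hR => le_iInf fun hj => ?_⟩
  obtain ⟨D, hD, hcover, hint⟩ := exists_cell_complement w hq m
  have hC : IsClosed (cellMap q w m '' gasket q) :=
    ((isCompact_gasket q).image (continuous_cellMap q w m)).isClosed
  obtain ⟨u, ⟨huC, huD⟩, R₁, hR₁, R₂, hR₂, hc, hj₁, hj₂, hu⟩ :=
    exists_split_of_joinedIn hj hC hD (hR.trans hcover)
      ((finite_range fun i => cellMap q w m (q i)).subset fun x hx => by
        obtain ⟨i, hi⟩ := hint x hx.1 hx.2; exact ⟨i, hi.symm⟩)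
      ((hcover ha).resolve_left hac) (mem_image_of_mem _ hy)
  obtain ⟨i, rfl⟩ := hint u huC huD
  refine (hi₀ i).trans (le_trans (add_le_add (lengthDist_le (hR₁.trans hR) hj₁) ?_)
    (hausdorffMeasure_add_le hR₁ (hR₂.trans inter_subset_left) hc hu))
  exact le_hausdorffMeasure_of_cell q w (fun R hR hj => ofReal_one_sub_coord_le hq i hy hR hj)
    (hR₂.trans inter_subset_right) hj₂

lemma intrinsicDist_self {a : Pt n} (ha : a ∈ gasket q) : intrinsicDist q a a = 0 := by
  rw [intrinsicDist_eq, lengthDist_self ha, ENNReal.toReal_zero]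

lemma dist_le_intrinsicDist (hq : IsUnitSimplex q) {a b : Pt n} (ha : a ∈ gasket q)
    (hb : b ∈ gasket q) : dist a b ≤ intrinsicDist q a b := by
  rw [intrinsicDist_eq]
  exact (ENNReal.ofReal_le_iff_le_toReal (lengthDist_lt_top hq ha hb).ne).1
    (ofReal_dist_le_lengthDist a b)

/-- The edges of all cells. -/
def cellEdges (q : Fin (n + 1) → Pt n) : Set (Set (Pt n)) :=
  {L | ∃ (w : ℕ → Fin (n + 1)) (m : ℕ) (i j : Fin (n + 1)),
    L = cellMap q w m '' segment ℝ (q i) (q j)}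

/-- The interior points of geodesics lie on edges of cells. -/
theorem mem_sUnion_cellEdges (hq : IsUnitSimplex q) {a b x : Pt n} (ha : a ∈ gasket q)
    (hb : b ∈ gasket q) (hx : x ∈ gasket q) (hxa : x ≠ a) (hxb : x ≠ b)
    (h : intrinsicDist q a x + intrinsicDist q x b = intrinsicDist q a b) :
    x ∈ ⋃₀ cellEdges q := by
  obtain ⟨w, rfl⟩ := hx
  have hx : addressPt q w ∈ gasket q := ⟨w, rfl⟩
  set x := addressPt q w with hxdef
  obtain ⟨M, hM⟩ := (isCompact_gasket q).isBounded.exists_pos_norm_le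
  obtain ⟨hM0, hM⟩ := hM
  -- The diameter of the gasket is at most `2 * M`, so a cell of level `m` around `x` misses `a` and
  -- `b` once `(1 / 2) ^ m` is below this quotient.
  have hδ : 0 < min (dist x a) (dist x b) / (2 * M) :=
    div_pos (lt_min (dist_pos.2 hxa) (dist_pos.2 hxb)) (by positivity)
  obtain ⟨m, hm⟩ := exists_pow_lt_of_lt_one hδ (show (1 / 2 : ℝ) < 1 by norm_num)
  rw [lt_div_iff₀ (by positivity)] at hm
  set y := addressPt q fun k => w (k + m) with hydef
  have hy : y ∈ gasket q := ⟨_, rfl⟩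
  have hxy : x = cellMap q w m y := (cellMap_addressPt q w m).symm
  have hout : ∀ c, min (dist x a) (dist x b) ≤ dist x c → c ∉ cellMap q w m '' gasket q := by
    rintro _ hc ⟨z, hz, rfl⟩
    rw [hxy, dist_cellMap, ← hxy] at hc
    have : dist y z ≤ 2 * M := by
      rw [dist_eq_norm]
      linarith [norm_sub_le y z, hM y hy, hM z hz]
    have h2 : (1 / 2 : ℝ) ^ m * dist y z ≤ (1 / 2) ^ m * (2 * M) := by gcongr
    linarith
  obtain ⟨i, hi⟩ := exists_corner_add_le hq w m ha (hout a (min_le_left _ _)) hy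
  obtain ⟨j, hj⟩ := exists_corner_add_le hq w m hb (hout b (min_le_right _ _)) hy
  rw [← hxy] at hi hj
  set u := cellMap q w m (q i) with hu
  set v := cellMap q w m (q j) with hv
  have hug : u ∈ gasket q := cellMap_mem_gasket q w m (vertex_mem_gasket q i)
  have hvg : v ∈ gasket q := cellMap_mem_gasket q w m (vertex_mem_gasket q j)
  have hfin : ∀ c ∈ gasket q, ∀ d ∈ gasket q, lengthDist q c d ≠ ∞ :=
    fun c hc d hd => (lengthDist_lt_top hq hc hd).ne
  have hpos : (0 : ℝ) < (1 / 2) ^ m := by positivity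
  have hreal : ∀ c ∈ gasket q, ∀ k,
      lengthDist q c (cellMap q w m (q k)) + ENNReal.ofReal ((1 / 2) ^ m * (1 - coord q k y)) ≤
        lengthDist q c x →
      intrinsicDist q c (cellMap q w m (q k)) + (1 / 2) ^ m * (1 - coord q k y) ≤
        intrinsicDist q c x := by
    intro c hc k hk
    have hk0 : 0 ≤ (1 / 2 : ℝ) ^ m * (1 - coord q k y) :=
      mul_nonneg hpos.le (sub_nonneg.2 (coord_le_one hq k hy))
    have := ENNReal.toReal_mono (hfin c hc x hx) hk
    rwa [ENNReal.toReal_add (hfin c hc _ (cellMap_mem_gasket q w m (vertex_mem_gasket q k)))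
      ENNReal.ofReal_ne_top, ENNReal.toReal_ofReal hk0, ← intrinsicDist_eq,
      ← intrinsicDist_eq] at this
  have hi' := hreal a ha i hi
  have hj' := hreal b hb j hj
  have hab : intrinsicDist q a b ≤
      intrinsicDist q a u + (1 / 2) ^ m * dist (q i) (q j) + intrinsicDist q b v := by
    simp only [intrinsicDist_eq]
    rw [← ENNReal.toReal_ofReal (show 0 ≤ (1 / 2 : ℝ) ^ m * dist (q i) (q j) by positivity),
      ← ENNReal.toReal_add (hfin a ha u hug) ENNReal.ofReal_ne_top, ← ENNReal.toReal_add
        (ENNReal.add_ne_top.2 ⟨hfin a ha u hug, ENNReal.ofReal_ne_top⟩) (hfin b hb v hvg)]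
    refine ENNReal.toReal_mono (ENNReal.add_ne_top.2 ⟨ENNReal.add_ne_top.2
      ⟨hfin a ha u hug, ENNReal.ofReal_ne_top⟩, hfin b hb v hvg⟩) ?_
    calc lengthDist q a b ≤ lengthDist q a v + lengthDist q v b := lengthDist_triangle _ _ _
      _ ≤ lengthDist q a u + lengthDist q u v + lengthDist q b v := by
          rw [lengthDist_comm v b]
          gcongr
          exact lengthDist_triangle _ _ _
      _ ≤ _ := by
          gcongr
          exact lengthDist_cell_corners w m i j
  have hsymm : intrinsicDist q x b = intrinsicDist q b x := by
    rw [intrinsicDist_eq, lengthDist_comm, intrinsicDist_eq]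
  -- The distances from `a` to `u` and from `b` to `v` cancel between the two lower bounds and the
  -- upper bound for `d(a,b)`.
  have hsum : (1 / 2 : ℝ) ^ m * ((1 - coord q i y) + (1 - coord q j y)) ≤
      (1 / 2) ^ m * dist (q i) (q j) := by
    linarith
  replace hsum := le_of_mul_le_mul_left hsum hpos
  refine ⟨_, ⟨w, m, i, j, rfl⟩, y, ?_, hxy.symm⟩
  rcases eq_or_ne i j with rfl | hij
  · rw [dist_self] at hsum
    rw [eq_vertex_of_coord hq hy (i := i) (by linarith)]
    exact left_mem_segment ℝ _ _
  · rw [hq i j hij] at hsum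
    exact mem_segment_of_coord hq hij hy (by linarith)

end LengthDistance

/-! ### Countability and dimension of the union of the edges. -/

section CellEdges

variable {n : ℕ} (q : Fin (n + 1) → Pt n)

lemma cellEdges_spec {L : Set (Pt n)} (hL : L ∈ cellEdges q) :
    L ⊆ gasket q ∧ ∃ u ∈ vertices q, ∃ v ∈ vertices q, L = segment ℝ u v := by
  obtain ⟨w, m, i, j, rfl⟩ := hL
  exact ⟨(image_mono (segment_subset_gasket q i j)).trans (image_cellMap_subset_gasket q w m),
    _, cellMap_mem_vertices q w m i, _, cellMap_mem_vertices q w m j,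
    image_cellMap_segment q w m _ _⟩

lemma countable_cellEdges : (cellEdges q).Countable := by
  refine (((countable_vertices q).prod (countable_vertices q)).image
    fun p : Pt n × Pt n => segment ℝ p.1 p.2).mono fun L hL => ?_
  obtain ⟨-, u, hu, v, hv, rfl⟩ := cellEdges_spec q hL
  exact ⟨(u, v), ⟨hu, hv⟩, rfl⟩

lemma dimH_sUnion_cellEdges_le : dimH (⋃₀ cellEdges q) ≤ 1 := by
  rw [dimH_sUnion (countable_cellEdges q)]
  refine iSup₂_le fun L hL => ?_
  obtain ⟨-, u, -, v, -, rfl⟩ := cellEdges_spec q hL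
  refine dimH_le_of_hausdorffMeasure_ne_top (d := 1) ?_
  rw [NNReal.coe_one, hausdorffMeasure_segment]
  exact edist_ne_top u v

end CellEdges

/-! ### Interpolation sets: distinct pairs and the diagonal. -/

section Interpolation

variable {n : ℕ} {q : Fin (n + 1) → Pt n}

lemma iUnion_interpDistinct_subset (hq : IsUnitSimplex q) {A B : Set (Pt n)} (hA : A ⊆ gasket q)
    (hB : B ⊆ gasket q) : (⋃ t ∈ Ioo (0 : ℝ) 1, interpDistinct q t A B) ⊆ ⋃₀ cellEdges q := by
  intro x hx
  simp only [interpDistinct, mem_iUnion] at hx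
  obtain ⟨t, ht, a, ha, b, hb, hab, hxg, h1, h2⟩ := hx
  have hpos : 0 < intrinsicDist q a b :=
    (dist_pos.2 hab).trans_le (dist_le_intrinsicDist hq (hA ha) (hB hb))
  refine mem_sUnion_cellEdges hq (hA ha) (hB hb) hxg ?_ ?_ (by rw [h1, h2]; ring)
  · rintro rfl
    rw [intrinsicDist_self (hA ha)] at h1
    exact (mul_pos ht.1 hpos).ne h1
  · rintro rfl
    rw [intrinsicDist_self (hB hb)] at h2
    exact (mul_pos (sub_pos.2 ht.2) hpos).ne h2

lemma interpPt_self (hq : IsUnitSimplex q) {a : Pt n} (ha : a ∈ gasket q) (t : ℝ) :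
    interpPt q t a a = {a} := by
  ext x
  simp only [interpPt, mem_ofPred_eq, intrinsicDist_self ha, mul_zero, mem_singleton_iff]
  constructor
  · rintro ⟨hx, h, -⟩
    exact (dist_le_zero.1 (h ▸ dist_le_intrinsicDist hq ha hx)).symm
  · rintro rfl
    exact ⟨ha, intrinsicDist_self ha, intrinsicDist_self ha⟩

lemma iUnion_interp_eq (hq : IsUnitSimplex q) {A B : Set (Pt n)} (hA : A ⊆ gasket q) :
    (⋃ t ∈ Ioo (0 : ℝ) 1, interp q t A B) =
      (⋃ t ∈ Ioo (0 : ℝ) 1, interpDistinct q t A B) ∪ A ∩ B := by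
  ext x
  simp only [interp, interpDistinct, mem_iUnion, mem_union]
  constructor
  · rintro ⟨t, ht, a, ha, b, hb, hx⟩
    by_cases hab : a = b
    · subst hab
      rw [interpPt_self hq (hA ha)] at hx
      obtain rfl : x = a := hx
      exact Or.inr ⟨ha, hb⟩
    · exact Or.inl ⟨t, ht, a, ha, b, hb, hab, hx⟩
  · rintro (⟨t, ht, a, ha, b, hb, -, hx⟩ | ⟨ha, hb⟩)
    · exact ⟨t, ht, a, ha, b, hb, hx⟩
    -- Any `t` in the open interval would do.
    · refine ⟨1 / 2, by norm_num, x, ha, x, hb, ?_⟩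
      rw [interpPt_self hq (hA ha)]
      rfl

end Interpolation

/-! ### Self-similar measures of edges and cells. -/

section SelfSimilarMeasure

variable {n : ℕ} {q : Fin (n + 1) → Pt n} {p : Fin (n + 1) → ℝ≥0} {μ : Measure (Pt n)}

lemma IsSelfSimilarMeasure.measure_inter_gasket (hμ : IsSelfSimilarMeasure q p μ)
    (X : Set (Pt n)) : μ (X ∩ gasket q) = μ X :=
  measure_inter_conull hμ.supported

lemma IsSelfSimilarMeasure.measure_le_of_inter_subset (hμ : IsSelfSimilarMeasure q p μ)
    {X Y : Set (Pt n)} (h : X ∩ gasket q ⊆ Y) : μ X ≤ μ Y := by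
  rw [← hμ.measure_inter_gasket X]
  exact measure_mono h

lemma IsSelfSimilarMeasure.measure_edge (hq : IsUnitSimplex q) (hμ : IsSelfSimilarMeasure q p μ)
    (hn : 2 ≤ n) (i j : Fin (n + 1)) : μ (segment ℝ (q i) (q j)) = 0 := by
  have := hμ.prob
  set e := segment ℝ (q i) (q j)
  have hpre : ∀ k, μ (ifsMap q k ⁻¹' e) ≤ if k = i ∨ k = j then μ e else 0 := by
    intro k
    split_ifs with hk
    · refine hμ.measure_le_of_inter_subset ?_
      rintro z ⟨hz, hzg⟩
      refine mem_segment_of_coord_eq_zero hq hzg fun l hli hlj => ?_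
      have := coord_eq_zero_of_mem_segment hq hz hli hlj
      rw [coord_ifsMap hq, if_neg (by rintro rfl; tauto)] at this
      linarith
    · rw [← measure_empty (μ := μ)]
      refine hμ.measure_le_of_inter_subset ?_
      rintro z ⟨hz, hzg⟩
      push Not at hk
      have := coord_eq_zero_of_mem_segment hq hz hk.1 hk.2
      rw [coord_ifsMap hq, if_pos rfl] at this
      linarith [coord_nonneg hq k hzg]
  -- Here `n ≥ 2` enters: a third vertex `l` gives `μ e ≤ (1 - p l) * μ e` with `p l > 0`.
  obtain ⟨l, hl⟩ : ∃ l, l ∉ ({i, j} : Finset (Fin (n + 1))) := by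
    by_contra! h
    have := Finset.card_le_card (fun l _ => h l : Finset.univ ⊆ ({i, j} : Finset (Fin (n + 1))))
    rw [Finset.card_univ, Fintype.card_fin] at this
    have := Finset.card_le_two (a := i) (b := j)
    omega
  simp only [Finset.mem_insert, Finset.mem_singleton] at hl
  have hle : μ e ≤ ∑ k, (p k : ℝ≥0∞) * if k = l then 0 else μ e := by
    rw [hμ.selfSimilar e (isCompact_segment _ _).measurableSet (segment_subset_gasket q i j)]
    refine Finset.sum_le_sum fun k _ => ?_
    gcongr
    refine (hpre k).trans ?_
    rw [← hμ.selfSimilar e (isCompact_segment _ _).measurableSet (segment_subset_gasket q i j)]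
    split_ifs with h1 h2 <;> first | exact le_rfl | exact zero_le | exact absurd (h2 ▸ h1) hl
  have hreal : μ.real e ≤ (1 - p l) * μ.real e := by
    have h := ENNReal.toReal_mono (ENNReal.sum_ne_top.2 fun k _ => ENNReal.mul_ne_top
      ENNReal.coe_ne_top (by split_ifs <;> simp)) hle
    rw [ENNReal.toReal_sum fun k _ => ENNReal.mul_ne_top ENNReal.coe_ne_top
      (by split_ifs <;> simp)] at h
    refine h.trans_eq ?_
    have hsum : ∑ k, (p k : ℝ) = 1 := by exact_mod_cast hμ.weight_sum
    rw [← hsum, sub_mul, Finset.sum_mul]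
    have : ∀ k, ((p k : ℝ≥0∞) * if k = l then 0 else μ e).toReal =
        p k * μ.real e - if k = l then p k * μ.real e else 0 := by
      intro k
      split_ifs <;> simp [measureReal_def]
    simp only [this, Finset.sum_sub_distrib, Finset.sum_ite_eq', Finset.mem_univ, if_true]
  have hp : (0 : ℝ) < p l := hμ.weight_pos l
  have h0 : (0 : ℝ) ≤ μ.real e := measureReal_nonneg
  rw [← measureReal_eq_zero_iff]
  nlinarith

lemma IsSelfSimilarMeasure.measure_image_ifsMap (hq : IsUnitSimplex q)
    (hμ : IsSelfSimilarMeasure q p μ) (hn : 2 ≤ n) {X : Set (Pt n)} (hX : IsCompact X)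
    (hXg : X ⊆ gasket q) (h0 : μ X = 0) (k : Fin (n + 1)) : μ (ifsMap q k '' X) = 0 := by
  rw [hμ.selfSimilar _ (hX.image (continuous_ifsMap q k)).measurableSet]
  · refine Finset.sum_eq_zero fun i _ => ?_
    rcases eq_or_ne i k with rfl | hik
    · rw [preimage_image_eq _ (ifsMap_injective q i), h0, mul_zero]
    · refine mul_eq_zero_of_right _ (le_antisymm ?_ zero_le)
      -- The preimage meets the gasket at most in `q k`, which is null as a degenerate edge.
      rw [← hμ.measure_edge hq hn k k]
      refine hμ.measure_le_of_inter_subset ?_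
      rintro z ⟨⟨x, hx, hxz⟩, hz⟩
      rw [eq_vertex_of_ifsMap_eq hq hik hz (hXg hx) hxz.symm]
      exact left_mem_segment ℝ _ _
  · rintro _ ⟨x, hx, rfl⟩
    exact ifsMap_mem_gasket q k (hXg hx)

lemma IsSelfSimilarMeasure.measure_image_cellMap (hq : IsUnitSimplex q)
    (hμ : IsSelfSimilarMeasure q p μ) (hn : 2 ≤ n) {X : Set (Pt n)} (hX : IsCompact X)
    (hXg : X ⊆ gasket q) (h0 : μ X = 0) (w : ℕ → Fin (n + 1)) (m : ℕ) :
    μ (cellMap q w m '' X) = 0 := by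
  induction m generalizing X with
  | zero => simpa only [cellMap_zero, image_id'] using h0
  | succ m ih =>
    have : cellMap q w (m + 1) '' X = cellMap q w m '' (ifsMap q (w m) '' X) := by
      rw [image_image]
      simp only [cellMap_succ]
    rw [this]
    refine ih (hX.image (continuous_ifsMap q _)) ?_ (hμ.measure_image_ifsMap hq hn hX hXg h0 _)
    rintro _ ⟨x, hx, rfl⟩
    exact ifsMap_mem_gasket q _ (hXg hx)

lemma IsSelfSimilarMeasure.measure_sUnion_cellEdges (hq : IsUnitSimplex q)
    (hμ : IsSelfSimilarMeasure q p μ) (hn : 2 ≤ n) : μ (⋃₀ cellEdges q) = 0 := by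
  rw [measure_sUnion_null_iff (countable_cellEdges q)]
  rintro _ ⟨w, m, i, j, rfl⟩
  exact hμ.measure_image_cellMap hq hn (isCompact_segment _ _) (segment_subset_gasket q i j)
    (hμ.measure_edge hq hn i j) w m

lemma IsSelfSimilarMeasure.measure_image_ifsMap_pos (hμ : IsSelfSimilarMeasure q p μ)
    {X : Set (Pt n)} (hX : IsCompact X) (hXg : X ⊆ gasket q) (h0 : 0 < μ X) (k : Fin (n + 1)) :
    0 < μ (ifsMap q k '' X) := by
  rw [hμ.selfSimilar _ (hX.image (continuous_ifsMap q k)).measurableSet]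
  · refine lt_of_lt_of_le ?_ (Finset.single_le_sum (f := fun i =>
      (p i : ℝ≥0∞) * μ (ifsMap q i ⁻¹' (ifsMap q k '' X))) (fun _ _ => zero_le)
      (Finset.mem_univ k))
    simp only [preimage_image_eq _ (ifsMap_injective q k)]
    exact ENNReal.mul_pos (by simpa using (hμ.weight_pos k).ne') h0.ne'
  · rintro _ ⟨x, hx, rfl⟩
    exact ifsMap_mem_gasket q k (hXg hx)

lemma IsSelfSimilarMeasure.measure_gasket (hμ : IsSelfSimilarMeasure q p μ) :
    μ (gasket q) = 1 := by
  have := hμ.prob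
  rw [← univ_inter (gasket q), hμ.measure_inter_gasket, measure_univ]

lemma measure_iUnion_interp (hq : IsUnitSimplex q) (hμ : IsSelfSimilarMeasure q p μ) (hn : 2 ≤ n)
    {A B : Set (Pt n)} (hA : A ⊆ gasket q) (hB : B ⊆ gasket q) :
    μ (⋃ t ∈ Ioo (0 : ℝ) 1, interpDistinct q t A B) = 0 ∧
      μ (⋃ t ∈ Ioo (0 : ℝ) 1, interp q t A B) = μ (A ∩ B) := by
  have h0 := measure_mono_null (iUnion_interpDistinct_subset hq hA hB)
    (hμ.measure_sUnion_cellEdges hq hn)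
  refine ⟨h0, ?_⟩
  rw [iUnion_interp_eq hq hA]
  refine le_antisymm ((measure_union_le _ _).trans ?_) (measure_mono subset_union_right)
  rw [h0, zero_add]

/-- Level two is needed, since cells of level one touch. A common point would make `q j` a point of
`F_i(S)`. -/
lemma disjoint_image_ifsMap_ifsMap (hq : IsUnitSimplex q) {i j : Fin (n + 1)} (hij : i ≠ j) :
    Disjoint (ifsMap q i '' (ifsMap q i '' gasket q)) (ifsMap q j '' (ifsMap q j '' gasket q)) := by
  rw [Set.disjoint_left]
  rintro _ ⟨_, ⟨x, hx, rfl⟩, rfl⟩ ⟨_, ⟨y, hy, rfl⟩, h⟩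
  have h1 := eq_vertex_of_ifsMap_eq hq hij (ifsMap_mem_gasket q i hx) (ifsMap_mem_gasket q j hy)
    h.symm
  exact hij (eq_of_ifsMap_eq_vertex hq hx h1)

lemma exists_not_brunnMinkowski (hq : IsUnitSimplex q) (hμ : IsSelfSimilarMeasure q p μ)
    (hn : 2 ≤ n) : ∃ A ⊆ gasket q, ∃ B ⊆ gasket q,
      IsCompact A ∧ IsCompact B ∧ Disjoint A B ∧ 0 < μ A ∧ 0 < μ B ∧
      ∀ t ∈ Ioo (0 : ℝ) 1, ∀ r : ℝ, 0 < r →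
        (μ.real (interp q t A B)) ^ r < (1 - t) * (μ.real A) ^ r + t * (μ.real B) ^ r := by
  have := hμ.prob
  have hS := isCompact_gasket q
  have hsub : ∀ k, ifsMap q k '' gasket q ⊆ gasket q := by
    rintro k _ ⟨x, hx, rfl⟩
    exact ifsMap_mem_gasket q k hx
  have hc : ∀ k, IsCompact (ifsMap q k '' gasket q) := fun k => hS.image (continuous_ifsMap q k)
  have hpos : ∀ k, 0 < μ (ifsMap q k '' (ifsMap q k '' gasket q)) := fun k =>
    hμ.measure_image_ifsMap_pos (hc k) (hsub k) (hμ.measure_image_ifsMap_pos hS subset_rfl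
      (by rw [hμ.measure_gasket]; exact one_pos) k) k
  have hsub' : ∀ k, ifsMap q k '' (ifsMap q k '' gasket q) ⊆ gasket q := fun k =>
    (image_mono (hsub k)).trans (hsub k)
  have hne : (0 : Fin (n + 1)) ≠ Fin.last n := by
    intro h
    have := congrArg Fin.val h
    simp at this
    omega
  have hdis := disjoint_image_ifsMap_ifsMap hq hne
  refine ⟨_, hsub' 0, _, hsub' (Fin.last n), (hc 0).image (continuous_ifsMap q 0),
    (hc _).image (continuous_ifsMap q _), hdis, hpos 0, hpos _, fun t ht r hr => ?_⟩
  have hzero : μ (interp q t (ifsMap q 0 '' (ifsMap q 0 '' gasket q))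
      (ifsMap q (Fin.last n) '' (ifsMap q (Fin.last n) '' gasket q))) = 0 := by
    refine measure_mono_null (subset_biUnion_of_mem (u := fun t => interp q t _ _) ht) ?_
    rw [(measure_iUnion_interp hq hμ hn (hsub' 0) (hsub' _)).2, hdis.inter_eq, measure_empty]
  rw [measureReal_def, hzero, ENNReal.toReal_zero, Real.zero_rpow hr.ne']
  have hp : ∀ k, 0 < (μ.real (ifsMap q k '' (ifsMap q k '' gasket q))) ^ r := fun k =>
    Real.rpow_pos_of_pos (ENNReal.toReal_pos (hpos k).ne' (measure_ne_top μ _)) r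
  exact add_pos (mul_pos (sub_pos.2 ht.2) (hp 0)) (mul_pos ht.1 (hp _))

end SelfSimilarMeasure

end SierpinskiGasket

theorem mainTheorem5 (n : ℕ) (q : Fin (n + 1) → SierpinskiGasket.Pt n)
    (hq : SierpinskiGasket.IsUnitSimplex q) :
    -- countably many segments joining vertices, independent of the two sets
    (∃ 𝓛 : Set (Set (SierpinskiGasket.Pt n)), 𝓛.Countable ∧
      (∀ L ∈ 𝓛, L ⊆ SierpinskiGasket.gasket q ∧
        ∃ u ∈ SierpinskiGasket.vertices q, ∃ v ∈ SierpinskiGasket.vertices q, L = segment ℝ u v) ∧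
      ∀ A ⊆ SierpinskiGasket.gasket q, ∀ B ⊆ SierpinskiGasket.gasket q,
        (⋃ t ∈ Ioo (0 : ℝ) 1, SierpinskiGasket.interpDistinct q t A B) ⊆ ⋃₀ 𝓛) ∧
    -- Hausdorff dimension
    (∀ A ⊆ SierpinskiGasket.gasket q, ∀ B ⊆ SierpinskiGasket.gasket q,
      dimH (⋃ t ∈ Ioo (0 : ℝ) 1, SierpinskiGasket.interpDistinct q t A B) ≤ 1 ∧
      dimH (⋃ t ∈ Ioo (0 : ℝ) 1, SierpinskiGasket.interp q t A B) ≤ max 1 (dimH (A ∩ B))) ∧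
    -- self-similar measure, and failure of every Brunn–Minkowski inequality
    (2 ≤ n → ∀ (p : Fin (n + 1) → ℝ≥0) (μ : Measure (SierpinskiGasket.Pt n)),
      SierpinskiGasket.IsSelfSimilarMeasure q p μ →
      (∀ A ⊆ SierpinskiGasket.gasket q, ∀ B ⊆ SierpinskiGasket.gasket q,
        μ (⋃ t ∈ Ioo (0 : ℝ) 1, SierpinskiGasket.interpDistinct q t A B) = 0 ∧
        μ (⋃ t ∈ Ioo (0 : ℝ) 1, SierpinskiGasket.interp q t A B) = μ (A ∩ B)) ∧
      ∃ A ⊆ SierpinskiGasket.gasket q, ∃ B ⊆ SierpinskiGasket.gasket q,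
        IsCompact A ∧ IsCompact B ∧ Disjoint A B ∧ 0 < μ A ∧ 0 < μ B ∧
        ∀ t ∈ Ioo (0 : ℝ) 1, ∀ r : ℝ, 0 < r →
          (μ.real (SierpinskiGasket.interp q t A B)) ^ r <
            (1 - t) * (μ.real A) ^ r + t * (μ.real B) ^ r) := by
  refine ⟨⟨SierpinskiGasket.cellEdges q, SierpinskiGasket.countable_cellEdges q,
    fun L hL => SierpinskiGasket.cellEdges_spec q hL,
    fun A hA B hB => SierpinskiGasket.iUnion_interpDistinct_subset hq hA hB⟩,
    fun A hA B hB => ?_, fun hn p μ hμ => ⟨fun A hA B hB =>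
      SierpinskiGasket.measure_iUnion_interp hq hμ hn hA hB,
      SierpinskiGasket.exists_not_brunnMinkowski hq hμ hn⟩⟩
  have h1 := (dimH_mono (SierpinskiGasket.iUnion_interpDistinct_subset hq hA hB)).trans
    (SierpinskiGasket.dimH_sUnion_cellEdges_le q)
  refine ⟨h1, ?_⟩
  rw [SierpinskiGasket.iUnion_interp_eq hq hA, dimH_union]
  exact max_le_max h1 le_rfl
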